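/- Let $\mathcal M$ be a smooth supermanifold of dimension $(s,r)$ over a smooth (Hausdorff, second countable) manifold $M$, i.e. $M$ is equipped with a sheaf of real superalgebras locally isomorphic to $C^\infty\otimes\Lambda^\bullet(\xi^1,\dots,\xi^r)$. Let $\mathcal A$ be its superalgebra of global functions and $\mathfrak g=\mathfrak g_0\oplus\mathfrak g_1$ the Lie superalgebra of vector fields on $\mathcal M$ (the superderivations of $\mathcal A$, with the supercommutator). Let $V\to M$ be a smooth real vector bundle of rank $r$ and fix a splitting $\mathcal M\cong\Pi V$, i.e. an isomorphism of superalgebras $\mathcal A\cong\Gamma(\Lambda^\bullet V^*)$. Let $\epsilon\in\mathfrak g_0$ be the corresponding Euler vector field, which acts on the functions corresponding to $\Gamma(\Lambda^kV^*)$ as multiplication by $k$, and put $\mathfrak g^k=\{X\in\mathfrak g : [\epsilon,X]=kX\}$ for $k\in\mathbb Z$. Call $X\in\mathfrak g_0$ ad-nilpotent if there is an integer $m\ge 0$ with $\mathrm{ad}_X^m(Y)=0$ for all $Y\in\mathfrak g$. Then, among the ideals of the Lie algebra $\mathfrak g_0$ all of whose elements are ad-nilpotent, there is a largest one; and every ideal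 $\mathfrak g'$ that is maximal among them satisfies $$\mathfrak g'=\bigoplus_{i>0}\mathfrak g^{2i}.$$ Consequently the subspace $\bigoplus_{i>0}\mathfrak g^{2i}$ of $\mathfrak g$ does not depend on the chosen splitting: any two splittings $\mathcal M\cong\Pi V$ and $\mathcal M\cong\Pi V'$ give the same subspace. -/

import Mathlib

open scoped Manifold ContDiff Topology TensorProduct
open TopologicalSpace Bundle

universe u

-- the commutator bracket on an associative algebra
attribute [local instance] LieRing.ofAssociativeRing

noncomputable section

/-! ### Superderivations of a superalgebra -/

section SuperDerivations

variable {A : Type*} [Ring A] [Algebra ℝ A] (𝒜 : ZMod 2 → Submodule ℝ A)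

/-- The homogeneous superderivations of parity `p` of the superalgebra `A = 𝒜 0 ⊕ 𝒜 1`. -/
def superDer (p : ZMod 2) : Submodule ℝ (Module.End ℝ A) where
  carrier := {D | ∀ q, ∀ a ∈ 𝒜 q, D a ∈ 𝒜 (p + q) ∧
    ∀ b, D (a * b) = D a * b + (-1 : ℝ) ^ (p.val * q.val) • (a * D b)}
  zero_mem' := fun q a _ => by simp
  add_mem' := by
    intro D E hD hE q a ha
    refine ⟨Submodule.add_mem _ (hD q a ha).1 (hE q a ha).1, fun b => ?_⟩
    simp only [LinearMap.add_apply, (hD q a ha).2 b, (hE q a ha).2 b, add_mul, mul_add, smul_add]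
    abel
  smul_mem' := by
    intro c D hD q a ha
    refine ⟨Submodule.smul_mem _ c (hD q a ha).1, fun b => ?_⟩
    simp only [LinearMap.smul_apply, (hD q a ha).2 b, smul_add, smul_mul_assoc,
      mul_smul_comm, smul_comm c]

/-- All superderivations: sums of an even and an odd one. -/
def superDerAll : Submodule ℝ (Module.End ℝ A) := superDer 𝒜 0 ⊔ superDer 𝒜 1

variable [GradedAlgebra 𝒜]

/-- The component of parity `p` of a linear operator on `A = 𝒜 0 ⊕ 𝒜 1`. -/
def endComponent (p : ZMod 2) (X : Module.End ℝ A) : Module.End ℝ A :=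
  ∑ q : ZMod 2, GradedAlgebra.proj 𝒜 (p + q) * X * GradedAlgebra.proj 𝒜 q

/-- The supercommutator: `[X, Y] = X Y - (-1)^{|X| |Y|} Y X` for homogeneous `X`, `Y`, extended
bilinearly. -/
def superBracket (X Y : Module.End ℝ A) : Module.End ℝ A :=
  ∑ p : ZMod 2, ∑ q : ZMod 2,
    (endComponent 𝒜 p X * endComponent 𝒜 q Y -
      (-1 : ℝ) ^ (p.val * q.val) • (endComponent 𝒜 q Y * endComponent 𝒜 p X))

theorem sum_proj (a : A) : ∑ q : ZMod 2, GradedAlgebra.proj 𝒜 q a = a := by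
  classical
  conv_rhs => rw [← DirectSum.sum_support_decompose 𝒜 a]
  symm
  refine (Finset.sum_subset (Finset.subset_univ _) ?_).trans ?_
  · intro i _ hi
    simpa using hi
  · rfl

theorem endComponent_of_homogeneous {p : ZMod 2} {X : Module.End ℝ A}
    (hX : ∀ q, ∀ a ∈ 𝒜 q, X a ∈ 𝒜 (p + q)) (p' : ZMod 2) :
    endComponent 𝒜 p' X = if p' = p then X else 0 := by
  ext a
  have key : ∀ q, GradedAlgebra.proj 𝒜 (p' + q) (X (GradedAlgebra.proj 𝒜 q a)) =
      if p' = p then X (GradedAlgebra.proj 𝒜 q a) else 0 := by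
    intro q
    have h := hX q _ (SetLike.coe_mem (DirectSum.decompose 𝒜 a q))
    rw [GradedAlgebra.proj_apply, GradedAlgebra.proj_apply]
    split_ifs with hp
    · subst hp
      exact DirectSum.decompose_of_mem_same 𝒜 h
    · refine DirectSum.decompose_of_mem_ne 𝒜 h ?_
      intro hh
      exact hp (add_right_cancel hh).symm
  simp only [endComponent, LinearMap.sum_apply, Module.End.mul_apply, key]
  split_ifs with hp
  · rw [← map_sum, sum_proj]
  · simp

theorem sum_endComponent (X : Module.End ℝ A) : ∑ p, endComponent 𝒜 p X = X := by
  ext a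
  simp only [endComponent, LinearMap.sum_apply, Module.End.mul_apply]
  rw [Finset.sum_comm]
  have : ∀ q, ∑ p, GradedAlgebra.proj 𝒜 (p + q) (X (GradedAlgebra.proj 𝒜 q a)) =
      X (GradedAlgebra.proj 𝒜 q a) := by
    intro q
    rw [← sum_proj 𝒜 (X (GradedAlgebra.proj 𝒜 q a))]
    exact Fintype.sum_equiv (Equiv.addRight q) _ _ (fun x => by
      rw [sum_proj]; rfl)
  simp only [this]
  rw [← map_sum, sum_proj]

/-- With an even operator, the supercommutator is the commutator. -/
theorem superBracket_even {X : Module.End ℝ A} (hX : X ∈ superDer 𝒜 0) (Y : Module.End ℝ A) :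
    superBracket 𝒜 X Y = X * Y - Y * X := by
  have h := endComponent_of_homogeneous 𝒜 (fun q a ha => (hX q a ha).1)
  have hc : ∀ p : ZMod 2, p.val = 0 ∨ p ≠ 0 := by decide
  have : ∀ p q : ZMod 2, (endComponent 𝒜 p X * endComponent 𝒜 q Y -
      (-1 : ℝ) ^ (p.val * q.val) • (endComponent 𝒜 q Y * endComponent 𝒜 p X)) =
      endComponent 𝒜 p X * endComponent 𝒜 q Y - endComponent 𝒜 q Y * endComponent 𝒜 p X := by
    intro p q
    rcases hc p with hp | hp
    · simp [hp]
    · rw [h, if_neg hp]; simp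
  simp only [superBracket, this, Finset.sum_sub_distrib, ← Finset.mul_sum, ← Finset.sum_mul,
    sum_endComponent]

/-- The superderivations are closed under the supercommutator. -/
theorem superBracket_mem {p q : ZMod 2} {X Y : Module.End ℝ A} (hX : X ∈ superDer 𝒜 p)
    (hY : Y ∈ superDer 𝒜 q) : superBracket 𝒜 X Y ∈ superDer 𝒜 (p + q) := by
  have hx := endComponent_of_homogeneous 𝒜 (fun q a ha => (hX q a ha).1)
  have hy := endComponent_of_homogeneous 𝒜 (fun q a ha => (hY q a ha).1)
  have : superBracket 𝒜 X Y = X * Y - (-1 : ℝ) ^ (p.val * q.val) • (Y * X) := by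
    unfold superBracket
    rw [Finset.sum_eq_single p, Finset.sum_eq_single q]
    · simp [hx, hy]
    · intro b _ hb; simp [hy, hb]
    · simp
    · intro b _ hb; simp [hx, hb]
    · simp
  rw [this]
  intro t a ha
  have hXa := hX t a ha
  have hYa := hY t a ha
  have hYXa := hY _ _ hXa.1
  have hXYa := hX _ _ hYa.1
  refine ⟨?_, fun b => ?_⟩
  · refine Submodule.sub_mem _ ?_ (Submodule.smul_mem _ _ ?_)
    · rw [add_assoc]; exact hXYa.1
    · rw [add_comm p q, add_assoc]; exact hYXa.1
  · simp only [LinearMap.sub_apply, Module.End.mul_apply, LinearMap.smul_apply, hXa.2, hYa.2,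
      map_add, map_smul, hYXa.2, hXYa.2]
    generalize X (Y a) = u1
    generalize Y (X a) = u2
    have e : ∀ p : ZMod 2, p = 0 ∨ p = 1 := by decide
    have e2 : (1 + 1 : ZMod 2) = 0 := rfl
    rcases e p with rfl | rfl <;> rcases e q with rfl | rfl <;> rcases e t with rfl | rfl <;>
      simp [ZMod.val_one, e2, sub_mul, add_mul, mul_sub, mul_add, smul_sub] <;> abel

/-- The Lie algebra of even superderivations of `A`, under the (super)commutator. -/
def evenDer : LieSubalgebra ℝ (Module.End ℝ A) where
  __ := superDer 𝒜 0
  lie_mem' := by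
    intro X Y hX hY
    have h := superBracket_mem 𝒜 hX hY
    rw [superBracket_even 𝒜 hX] at h
    exact h

/-- `X` acts nilpotently on the Lie superalgebra of all superderivations by the adjoint
action. -/
def IsAdNilpotent (X : Module.End ℝ A) : Prop :=
  ∃ m : ℕ, ∀ Y ∈ superDerAll 𝒜, (superBracket 𝒜 X)^[m] Y = 0

/-- The ideals of the Lie algebra of even superderivations all of whose elements act nilpotently
on the Lie superalgebra of all superderivations. -/
def adNilpotentIdeals : Set (LieIdeal ℝ (evenDer 𝒜)) :=
  {J | ∀ X ∈ J, IsAdNilpotent 𝒜 (X : Module.End ℝ A)}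

end SuperDerivations

/-! ### Smooth supermanifolds -/

section Supermanifold

open CategoryTheory Opposite

variable {s : ℕ} {M : Type u} [TopologicalSpace M] [ChartedSpace (EuclideanSpace ℝ (Fin s)) M]

/-- Restriction of smooth functions from an open set to a smaller one. -/
def smoothRestrict {W W' : Opens M} (h : W' ≤ W) :
    C^∞⟮𝓡 s, W; 𝓘(ℝ, ℝ), ℝ⟯ →ₐ[ℝ] C^∞⟮𝓡 s, W'; 𝓘(ℝ, ℝ), ℝ⟯ where
  __ := ContMDiffMap.restrictRingHom (𝓡 s) 𝓘(ℝ, ℝ) ℝ h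
  commutes' _ := rfl

variable (s) in
/-- Functions on the local model over an open set `W` of the body:
`C^∞(W) ⊗ Λ(ξ¹, …, ξʳ)`. -/
abbrev LocalModel (r : ℕ) (W : Opens M) : Type u :=
  C^∞⟮𝓡 s, W; 𝓘(ℝ, ℝ), ℝ⟯ ⊗[ℝ] ExteriorAlgebra ℝ (Fin r → ℝ)

/-- Restriction of functions on the local model. -/
def LocalModel.restrict (r : ℕ) {W W' : Opens M} (h : W' ≤ W) :
    LocalModel s r W →ₐ[ℝ] LocalModel s r W' :=
  Algebra.TensorProduct.map (smoothRestrict h) (AlgHom.id ℝ _)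

/-- The part of parity `p` of the exterior algebra of `E`: the sum of the `Λᵏ E` with
`k ≡ p` modulo `2`. -/
abbrev exteriorParity (E : Type*) [AddCommGroup E] [Module ℝ E] (p : ZMod 2) :
    Submodule ℝ (ExteriorAlgebra ℝ E) :=
  CliffordAlgebra.evenOdd (0 : QuadraticForm ℝ E) p

/-- The part of parity `p` of the functions on the local model. -/
def LocalModel.parity (r : ℕ) (W : Opens M) (p : ZMod 2) : Submodule ℝ (LocalModel s r W) :=
  ((exteriorParity (Fin r → ℝ) p).baseChange C^∞⟮𝓡 s, W; 𝓘(ℝ, ℝ), ℝ⟯).restrictScalars ℝ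

variable (s M) in
/-- A smooth supermanifold of dimension `(s, r)` over the body `M`: a sheaf of real superalgebras
on the smooth `s`-dimensional manifold `M` which is locally isomorphic to
`C^∞ ⊗ Λ(ξ¹, …, ξʳ)`. -/
structure Supermanifold (r : ℕ) where
  /-- The structure sheaf. -/
  sheaf : TopCat.Sheaf (AlgCat.{u} ℝ) (TopCat.of M)
  /-- The even and odd functions over an open set. -/
  parity : ∀ U : Opens M, ZMod 2 → Submodule ℝ (sheaf.obj.obj (op U))
  [graded : ∀ U, GradedAlgebra (parity U)]
  restrict_parity : ∀ {U U' : Opens M} (h : U' ≤ U) (p : ZMod 2), ∀ a ∈ parity U p,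
    (sheaf.obj.map (homOfLE h).op).hom a ∈ parity U' p
  locally_model : ∀ x : M, ∃ U : Opens M, x ∈ U ∧
    ∃ e : ∀ W : Opens M, W ≤ U → (sheaf.obj.obj (op W) ≃ₐ[ℝ] LocalModel s r W),
      (∀ (W W' : Opens M) (hW : W ≤ U) (h : W' ≤ W) (a : sheaf.obj.obj (op W)),
        e W' (h.trans hW) ((sheaf.obj.map (homOfLE h).op).hom a) =
          LocalModel.restrict r h (e W hW a)) ∧
      (∀ (W : Opens M) (hW : W ≤ U) (p : ZMod 2) (a : sheaf.obj.obj (op W)),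
        a ∈ parity W p ↔ e W hW a ∈ LocalModel.parity r W p)

attribute [instance] Supermanifold.graded

variable {r : ℕ} (𝓜 : Supermanifold s M r)

/-- The superalgebra of smooth functions on a supermanifold. -/
abbrev Supermanifold.Functions : Type u := 𝓜.sheaf.obj.obj (op ⊤)

/-- The Lie superalgebra `𝔤` of vector fields on a supermanifold. -/
abbrev Supermanifold.vectorFields : Submodule ℝ (Module.End ℝ 𝓜.Functions) :=
  superDerAll (𝓜.parity ⊤)

/-- The Lie algebra `𝔤₀` of even vector fields on a supermanifold. -/
abbrev Supermanifold.evenVectorFields : LieSubalgebra ℝ (Module.End ℝ 𝓜.Functions) :=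
  evenDer (𝓜.parity ⊤)

end Supermanifold

/-! ### The exterior algebra of the dual of a vector bundle -/

section ExteriorSections

/-- The operator on the exterior algebra of `E` that multiplies `Λᵏ E` by `k`. -/
def exteriorDegree (E : Type*) [AddCommGroup E] [Module ℝ E] : Module.End ℝ (ExteriorAlgebra ℝ E) :=
  DirectSum.toModule ℝ ℕ _ (fun k => (k : ℝ) • (⋀[ℝ]^k E).subtype) ∘ₗ
    (DirectSum.decomposeLinearEquiv (fun k : ℕ => ⋀[ℝ]^k E)).toLinearMap

theorem exteriorDegree_of_mem {E : Type*} [AddCommGroup E] [Module ℝ E] {k : ℕ}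
    {a : ExteriorAlgebra ℝ E} (ha : a ∈ ⋀[ℝ]^k E) : exteriorDegree E a = (k : ℝ) • a := by
  lift a to ⋀[ℝ]^k E using ha
  simp only [exteriorDegree, LinearMap.comp_apply, LinearEquiv.coe_coe]
  rw [DirectSum.decomposeLinearEquiv_apply_coe (fun k : ℕ => ⋀[ℝ]^k E) k a,
    DirectSum.toModule_lof]
  simp

theorem exteriorDegree_mul {E : Type*} [AddCommGroup E] [Module ℝ E] (a b : ExteriorAlgebra ℝ E) :
    exteriorDegree E (a * b) = exteriorDegree E a * b + a * exteriorDegree E b := by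
  induction a using DirectSum.Decomposition.inductionOn (fun k : ℕ => ⋀[ℝ]^k E) with
  | zero => simp
  | add a a' ha ha' => simp only [add_mul, map_add, ha, ha']; abel
  | @homogeneous i a =>
    induction b using DirectSum.Decomposition.inductionOn (fun k : ℕ => ⋀[ℝ]^k E) with
    | zero => simp
    | add b b' hb hb' => simp only [mul_add, map_add, hb, hb']; abel
    | @homogeneous j b =>
      rw [exteriorDegree_of_mem (SetLike.mul_mem_graded a.2 b.2), exteriorDegree_of_mem a.2,
        exteriorDegree_of_mem b.2]
      simp [add_smul]

theorem exteriorDegree_eq_iff {E : Type*} [AddCommGroup E] [Module ℝ E] (k : ℕ)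
    (a : ExteriorAlgebra ℝ E) : exteriorDegree E a = (k : ℝ) • a ↔ a ∈ ⋀[ℝ]^k E := by
  classical
  refine ⟨fun h => ?_, exteriorDegree_of_mem⟩
  have key : ∀ (b : ExteriorAlgebra ℝ E) (j : ℕ),
      GradedAlgebra.proj (fun k : ℕ => ⋀[ℝ]^k E) j (exteriorDegree E b) =
        (j : ℝ) • GradedAlgebra.proj (fun k : ℕ => ⋀[ℝ]^k E) j b := by
    intro b j
    induction b using DirectSum.Decomposition.inductionOn (fun k : ℕ => ⋀[ℝ]^k E) with
    | zero => simp
    | add b b' hb hb' => simp only [map_add, hb, hb', smul_add]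
    | @homogeneous i b =>
      rw [exteriorDegree_of_mem b.2, map_smul]
      by_cases hij : i = j
      · subst hij
        rfl
      · rw [GradedAlgebra.proj_apply,
          DirectSum.decompose_of_mem_ne (fun k : ℕ => ⋀[ℝ]^k E) b.2 hij]
        simp
  rw [← DirectSum.sum_support_decompose (fun k : ℕ => ⋀[ℝ]^k E) a]
  refine Submodule.sum_mem _ fun j _ => ?_
  by_cases hj : j = k
  · subst hj
    exact SetLike.coe_mem _
  · have h1 := key a j
    rw [h, map_smul, ← sub_eq_zero, ← sub_smul, smul_eq_zero] at h1
    rcases h1 with h1 | h1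
    · rw [sub_eq_zero, Nat.cast_inj] at h1
      exact absurd h1.symm hj
    · rw [GradedAlgebra.proj_apply] at h1
      rw [h1]
      exact zero_mem _

theorem exteriorDegree_mem_parity {E : Type*} [AddCommGroup E] [Module ℝ E] {p : ZMod 2}
    {a : ExteriorAlgebra ℝ E} (ha : a ∈ exteriorParity E p) :
    exteriorDegree E a ∈ exteriorParity E p := by
  have : exteriorParity E p ≤ (exteriorParity E p).comap (exteriorDegree E) := by
    refine iSup_le fun j b hb => ?_
    rw [Submodule.mem_comap, exteriorDegree_of_mem (k := j) hb]
    exact Submodule.smul_mem _ _ (Submodule.mem_iSup_of_mem j hb)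
  exact this ha

variable (s : ℕ) {M : Type u} [TopologicalSpace M] [ChartedSpace (EuclideanSpace ℝ (Fin s)) M]
  (F : Type*) [NormedAddCommGroup F] [NormedSpace ℝ F]
  (V : M → Type*) [∀ x, AddCommGroup (V x)] [∀ x, Module ℝ (V x)] [∀ x, TopologicalSpace (V x)]
  [TopologicalSpace (TotalSpace F V)] [FiberBundle F V]

/-- `α` is a smooth section of the dual bundle `V*`: its pairing with any smooth section of `V`
over an open set is smooth. -/
def IsSmoothDualSection (α : ∀ x, Module.Dual ℝ (V x)) : Prop :=
  ∀ (U : Set M) (σ : ∀ x, V x), IsOpen U →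
    ContMDiffOn (𝓡 s) ((𝓡 s).prod 𝓘(ℝ, F)) ∞ (fun x => TotalSpace.mk' F x (σ x)) U →
    ContMDiffOn (𝓡 s) 𝓘(ℝ, ℝ) ∞ (fun x => α x (σ x)) U

/-- The families `x ↦ θ x ∈ Λ(V_x*)` that are smooth functions or smooth sections of `V*`. -/
def exteriorGenerators : Set (∀ x, ExteriorAlgebra ℝ (Module.Dual ℝ (V x))) :=
  {θ | ∃ f : C^∞⟮𝓡 s, M; 𝓘(ℝ, ℝ), ℝ⟯, θ = fun x => algebraMap ℝ _ (f x)} ∪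
  {θ | ∃ α : ∀ x, Module.Dual ℝ (V x), IsSmoothDualSection s F V α ∧
    θ = fun x => ExteriorAlgebra.ι ℝ (α x)}

/-- The algebra `Γ(Λ• V*)` of smooth sections of the exterior algebra bundle of `V*`. A section
is smooth if near each point it agrees with a sum of exterior products of smooth functions
and smooth sections of `V*`. (On a Hausdorff manifold, smooth functions and sections of `V*`
defined near a point agree near that point with globally defined ones.) -/
def exteriorSections : Subalgebra ℝ (∀ x, ExteriorAlgebra ℝ (Module.Dual ℝ (V x))) where
  carrier := {θ | ∀ x₀, ∃ η ∈ Algebra.adjoin ℝ (exteriorGenerators s F V), ∀ᶠ x in 𝓝 x₀, θ x = η x}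
  mul_mem' := by
    intro θ θ' h h' x₀
    obtain ⟨η, hη, e⟩ := h x₀
    obtain ⟨η', hη', e'⟩ := h' x₀
    refine ⟨η * η', mul_mem hη hη', ?_⟩
    filter_upwards [e, e'] with x h1 h2
    simp [h1, h2]
  add_mem' := by
    intro θ θ' h h' x₀
    obtain ⟨η, hη, e⟩ := h x₀
    obtain ⟨η', hη', e'⟩ := h' x₀
    refine ⟨η + η', add_mem hη hη', ?_⟩
    filter_upwards [e, e'] with x h1 h2
    simp [h1, h2]
  algebraMap_mem' c x₀ := ⟨_, Subalgebra.algebraMap_mem _ c, Filter.Eventually.of_forall fun _ => rfl⟩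

theorem exteriorDegree_mem_adjoin {η : ∀ x, ExteriorAlgebra ℝ (Module.Dual ℝ (V x))}
    (hη : η ∈ Algebra.adjoin ℝ (exteriorGenerators s F V)) :
    (fun x => exteriorDegree _ (η x)) ∈ Algebra.adjoin ℝ (exteriorGenerators s F V) := by
  have hs : ∀ (x : M) (c : ℝ),
      exteriorDegree (Module.Dual ℝ (V x)) (algebraMap ℝ _ c) = 0 := by
    intro x c
    rw [exteriorDegree_of_mem (k := 0) (SetLike.algebraMap_mem_graded _ c)]
    simp
  induction hη using Algebra.adjoin_induction with
  | mem η h =>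
    rcases h with ⟨f, rfl⟩ | ⟨α, hα, rfl⟩
    · simp only [hs]
      exact zero_mem _
    · have : ∀ x, exteriorDegree _ (ExteriorAlgebra.ι ℝ (α x)) = ExteriorAlgebra.ι ℝ (α x) := by
        intro x
        rw [exteriorDegree_of_mem (k := 1) (by simp)]
        simp
      simp only [this]
      exact Algebra.subset_adjoin (Or.inr ⟨α, hα, rfl⟩)
  | algebraMap c =>
    simp only [Pi.algebraMap_apply, hs]
    exact zero_mem _
  | add η η' _ _ h h' =>
    simp only [Pi.add_apply, map_add]
    exact add_mem h h'
  | mul η η' hη hη' h h' =>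
    simp only [Pi.mul_apply, exteriorDegree_mul]
    exact add_mem (mul_mem h hη') (mul_mem hη h')

/-- The operator on `Γ(Λ• V*)` that multiplies `Γ(Λᵏ V*)` by `k`. -/
def eulerOnSections : Module.End ℝ (exteriorSections s F V) where
  toFun θ := ⟨fun x => exteriorDegree _ (θ.1 x), fun x₀ => by
    obtain ⟨η, hη, e⟩ := θ.2 x₀
    refine ⟨_, exteriorDegree_mem_adjoin s F V hη, ?_⟩
    filter_upwards [e] with x hx
    rw [hx]⟩
  map_add' θ θ' := Subtype.ext (funext fun x => by simp)
  map_smul' c θ := Subtype.ext (funext fun x => by simp)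

end ExteriorSections

/-! ### Splittings and the induced grading -/

section Splitting

variable {s : ℕ} {M : Type u} [TopologicalSpace M] [ChartedSpace (EuclideanSpace ℝ (Fin s)) M]
  {r : ℕ} (𝓜 : Supermanifold s M r)
  (F : Type*) [NormedAddCommGroup F] [NormedSpace ℝ F]
  (V : M → Type*) [∀ x, AddCommGroup (V x)] [∀ x, Module ℝ (V x)] [∀ x, TopologicalSpace (V x)]
  [TopologicalSpace (TotalSpace F V)] [FiberBundle F V]

/-- An identification of the supermanifold with `ΠV`: an isomorphism of superalgebras from the
smooth functions onto `Γ(Λ• V*)`. -/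
structure Splitting where
  toAlgEquiv : 𝓜.Functions ≃ₐ[ℝ] exteriorSections s F V
  parity_iff : ∀ (p : ZMod 2) (a : 𝓜.Functions), a ∈ 𝓜.parity ⊤ p ↔
    ∀ x, (toAlgEquiv a).1 x ∈ exteriorParity (Module.Dual ℝ (V x)) p

variable {𝓜 F V}

/-- The functions of degree `k` for the `ℤ`-grading given by a splitting, corresponding to
`Γ(Λᵏ V*)`. -/
def Splitting.functionDegree (φ : Splitting 𝓜 F V) (k : ℕ) : Submodule ℝ 𝓜.Functions where
  carrier := {a | ∀ x, (φ.toAlgEquiv a).1 x ∈ ⋀[ℝ]^k (Module.Dual ℝ (V x))}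
  zero_mem' x := by simp
  add_mem' ha hb x := by simpa using add_mem (ha x) (hb x)
  smul_mem' c a ha x := by simpa using Submodule.smul_mem _ c (ha x)

/-- The Euler vector field of a splitting. -/
def Splitting.euler (φ : Splitting 𝓜 F V) : Module.End ℝ 𝓜.Functions :=
  φ.toAlgEquiv.symm.toLinearEquiv.conj (eulerOnSections s F V)

/-- The Euler vector field acts on the functions of degree `k`, and only on them, as
multiplication by `k`. -/
theorem Splitting.euler_eq_iff (φ : Splitting 𝓜 F V) (k : ℕ) (a : 𝓜.Functions) :
    φ.euler a = (k : ℝ) • a ↔ a ∈ φ.functionDegree k := by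
  have h1 : φ.euler a = (k : ℝ) • a ↔ ∀ x, exteriorDegree _ ((φ.toAlgEquiv a).1 x) =
      (k : ℝ) • (φ.toAlgEquiv a).1 x := by
    rw [← φ.toAlgEquiv.injective.eq_iff, Subtype.ext_iff, funext_iff]
    simp [Splitting.euler, LinearEquiv.conj_apply, eulerOnSections]
  rw [h1]
  exact forall_congr' fun x => exteriorDegree_eq_iff k _

theorem Splitting.apply_euler (φ : Splitting 𝓜 F V) (a : 𝓜.Functions) (x : M) :
    (φ.toAlgEquiv (φ.euler a)).1 x = exteriorDegree _ ((φ.toAlgEquiv a).1 x) := by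
  simp [Splitting.euler, LinearEquiv.conj_apply, eulerOnSections]

/-- The Euler vector field is an even vector field. -/
theorem Splitting.euler_mem (φ : Splitting 𝓜 F V) : φ.euler ∈ 𝓜.evenVectorFields := by
  intro q a ha
  refine ⟨?_, fun b => ?_⟩
  · rw [zero_add, φ.parity_iff]
    intro x
    rw [φ.apply_euler]
    exact exteriorDegree_mem_parity ((φ.parity_iff q a).1 ha x)
  · apply φ.toAlgEquiv.injective
    refine Subtype.ext (funext fun x => ?_)
    rw [φ.apply_euler]
    simp [φ.apply_euler, exteriorDegree_mul]

/-- The component `𝔤ᵏ = {X ∈ 𝔤 | [ε, X] = k X}` of the grading of the vector fields given by a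
splitting. -/
def Splitting.vectorFieldDegree (φ : Splitting 𝓜 F V) (k : ℤ) :
    Submodule ℝ (Module.End ℝ 𝓜.Functions) where
  carrier := {X | X ∈ 𝓜.vectorFields ∧ superBracket (𝓜.parity ⊤) φ.euler X = (k : ℝ) • X}
  zero_mem' := ⟨zero_mem _, by rw [superBracket_even _ φ.euler_mem]; simp⟩
  add_mem' := by
    rintro X Y ⟨hX, eX⟩ ⟨hY, eY⟩
    refine ⟨add_mem hX hY, ?_⟩
    rw [superBracket_even _ φ.euler_mem] at *
    rw [smul_add, ← eX, ← eY, mul_add, add_mul]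
    abel
  smul_mem' := by
    rintro c X ⟨hX, eX⟩
    refine ⟨Submodule.smul_mem _ c hX, ?_⟩
    rw [superBracket_even _ φ.euler_mem] at *
    rw [smul_comm, ← eX, smul_sub, mul_smul_comm, smul_mul_assoc]

end Splitting

end

/-! The operator `ad ε` diagonalises the vector fields. An even field is determined by its values on
functions of degree 0 and 1, and it preserves parity, so its homogeneous components have degrees 0,
2, 4, .... Hence the part of positive degree is an ideal of `𝔤₀`. Its elements raise the degree of
functions, and that degree is bounded by the rank of `V`, so they are nilpotent operators and
therefore ad-nilpotent.

Conversely, an ad-nilpotent ideal is stable under `ad ε` and so is spanned by its homogeneous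
elements. It remains to exclude a nonzero element `X` of degree 0.

Suppose that `X` has a nonzero symbol, i.e. `X f ≠ 0` at a point for some `f` of degree 0. Subtract
a constant from `f` so that it vanishes there, and put `g = X(f²)`. Then `gX = -[f²X, X]` lies in
the ideal, `g` vanishes at the point and `X g` does not. Bracketing `kX` with `gX` multiplies the
value of `k` at the point by `-(X g)`, so `gX` is not ad-nilpotent (`apply_eq_zero_of_degree_zero`).

So `X` is linear over the functions of degree 0. Applying powers of `ad X` to contractions shows
that `X` is nilpotent on degree 1 (`exists_pow_apply_eq_zero`). If it is nonzero there, some `α` has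
`γ = Xα ≠ 0` and `Xγ = 0`. Choose a contraction `D` with `g = Dγ` nonzero at a point. The ideal
contains `B = [αD, X]`, and `Bγ = -gγ`, which contradicts the nilpotency of `B` on degree 1
(`eq_zero_of_mem_adNilpotent_of_degree_zero`).

The argument uses only the properties collected in `IsEulerGrading`; bump functions, global sections
and fibrewise operators supply them for `Γ(Λ• V*)`. The largest ideal is defined without a
splitting, so its description by any splitting gives the same subspace. -/

/-! ### Invariant subspaces of a diagonalisable operator -/

section InvariantSubmodule

variable {K W : Type*} [Field K] [AddCommGroup W] [Module K W]

/-- An invariant submodule contained in the span of the eigenspaces is spanned by its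
intersections with them. -/
theorem le_iSup_inf_eigenspace {f : Module.End K W} {p : Submodule K W}
    (h : ∀ x ∈ p, f x ∈ p) (hp : p ≤ ⨆ μ, f.eigenspace μ) : p ≤ ⨆ μ, p ⊓ f.eigenspace μ := by
  classical
  intro x hx
  obtain ⟨m, hm, rfl⟩ := (Submodule.mem_iSup_iff_exists_finsupp _ _).mp (hp hx)
  refine (Submodule.mem_iSup_iff_exists_finsupp _ _).mpr ⟨m, fun μ => ⟨?_, hm μ⟩, rfl⟩
  by_cases hμ : μ ∈ m.support
  swap
  · rw [Finsupp.notMem_support_iff.mp hμ]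
    exact p.zero_mem
  have hinv : ∀ (q : Polynomial K), ∀ y ∈ p, Polynomial.aeval f q y ∈ p := by
    intro q y hy
    induction q using Polynomial.induction_on' with
    | add q q' hq hq' =>
      rw [map_add]
      exact p.add_mem hq hq'
    | monomial n c =>
      rw [Polynomial.aeval_monomial, Module.End.mul_apply, Module.algebraMap_end_apply]
      refine p.smul_mem _ ?_
      induction n with
      | zero => simpa using hy
      | succ n ih =>
        rw [pow_succ', Module.End.mul_apply]
        exact h _ ih
  -- The Lagrange polynomial equal to 1 at `μ` and 0 at the other eigenvalues in the support,
  -- evaluated at `f`, extracts the component of `x` at `μ`.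
  have key := hinv (Lagrange.basis m.support id μ) _ hx
  rw [Finsupp.sum, map_sum, Finset.sum_eq_single μ] at key
  · rw [Module.End.aeval_apply_of_hasEigenvector ⟨hm μ, Finsupp.mem_support_iff.mp hμ⟩] at key
    have h1 := Lagrange.eval_basis_self (v := (id : K → K)) (s := m.support)
      Function.injective_id.injOn hμ
    simp only [id] at h1 key
    rwa [h1, one_smul] at key
  · intro ν hν hne
    rw [Module.End.aeval_apply_of_hasEigenvector ⟨hm ν, Finsupp.mem_support_iff.mp hν⟩]
    have h1 := Lagrange.eval_basis_of_ne (v := (id : K → K)) (s := m.support) hne.symm hν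
    simp only [id] at h1 ⊢
    rw [h1, zero_smul]
  · exact fun hh => absurd hμ hh

end InvariantSubmodule

/-! ### Even superderivations and their adjoint action -/

section EvenSuperderivations

variable {A : Type*} [Ring A] [Algebra ℝ A] {𝒜 : ZMod 2 → Submodule ℝ A}

theorem superDer_one_apply_mul {D : Module.End ℝ A} (hD : D ∈ superDer 𝒜 1) {q : ZMod 2} {a : A}
    (ha : a ∈ 𝒜 q) (b : A) : D (a * b) = D a * b + (-1 : ℝ) ^ q.val • (a * D b) := by
  have := (hD q a ha).2 b
  rwa [ZMod.val_one, one_mul] at this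

variable [GradedAlgebra 𝒜]

theorem superDer_zero_apply_mul {X : Module.End ℝ A} (hX : X ∈ superDer 𝒜 0) (a b : A) :
    X (a * b) = X a * b + a * X b := by
  have h : ∀ q, ∀ a ∈ 𝒜 q, X (a * b) = X a * b + a * X b := by
    intro q a ha
    simpa using (hX q a ha).2 b
  rw [← sum_proj 𝒜 a]
  simp only [Finset.sum_mul, map_sum, ← Finset.sum_add_distrib]
  exact Finset.sum_congr rfl fun q _ => h q _ (SetLike.coe_mem (DirectSum.decompose 𝒜 a q))

theorem superDer_zero_apply_one {X : Module.End ℝ A} (hX : X ∈ superDer 𝒜 0) : X 1 = 0 := by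
  have := superDer_zero_apply_mul hX 1 1
  simpa using this

theorem superDer_zero_apply_algebraMap {X : Module.End ℝ A} (hX : X ∈ superDer 𝒜 0) (c : ℝ) :
    X (algebraMap ℝ A c) = 0 := by
  rw [Algebra.algebraMap_eq_smul_one, map_smul, superDer_zero_apply_one hX, smul_zero]

theorem commutator_mem_superDer_zero {X Y : Module.End ℝ A} (hX : X ∈ superDer 𝒜 0)
    (hY : Y ∈ superDer 𝒜 0) : X * Y - Y * X ∈ superDer 𝒜 0 := by
  have := superBracket_mem 𝒜 hX hY
  rwa [superBracket_even 𝒜 hX] at this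

theorem superBracket_iterate {X : Module.End ℝ A} (hX : X ∈ superDer 𝒜 0) (m : ℕ)
    (Y : Module.End ℝ A) :
    (superBracket 𝒜 X)^[m] Y = ((LieAlgebra.ad ℝ (Module.End ℝ A) X) ^ m) Y := by
  induction m with
  | zero => simp
  | succ m ih =>
    rw [Function.iterate_succ_apply', ih, superBracket_even 𝒜 hX, pow_succ', Module.End.mul_apply,
      LieAlgebra.ad_apply, Ring.lie_def]

/-- Left and right multiplication by `X` commute and are both nilpotent; `ad X` is their difference.
-/
theorem isAdNilpotent_of_isNilpotent {X : Module.End ℝ A} (hX : X ∈ superDer 𝒜 0)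
    (h : IsNilpotent X) : IsAdNilpotent 𝒜 X := by
  obtain ⟨m, hm⟩ := LieAlgebra.ad_nilpotent_of_nilpotent (R := ℝ) h
  refine ⟨m, fun Y _ => ?_⟩
  rw [superBracket_iterate hX, hm, LinearMap.zero_apply]

theorem eq_zero_of_mem_of_mem {p q : ZMod 2} (hpq : p ≠ q) {a : A} (hp : a ∈ 𝒜 p)
    (hq : a ∈ 𝒜 q) : a = 0 := by
  rw [← DirectSum.decompose_of_mem_same 𝒜 hp]
  exact DirectSum.decompose_of_mem_ne 𝒜 hq hpq.symm

/-- An ideal of even superderivations, viewed in the linear operators, absorbs commutators. -/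
theorem commutator_mem_of_mem_ideal {J : LieIdeal ℝ (evenDer 𝒜)} {X Y : Module.End ℝ A}
    (hX : X ∈ superDer 𝒜 0) (hY : Y ∈ J.toSubmodule.map (evenDer 𝒜).toSubmodule.subtype) :
    X * Y - Y * X ∈ J.toSubmodule.map (evenDer 𝒜).toSubmodule.subtype := by
  obtain ⟨Y, hY, rfl⟩ := hY
  refine ⟨⁅(⟨X, hX⟩ : evenDer 𝒜), Y⁆, lie_mem_right ℝ (evenDer 𝒜) J _ _ hY, ?_⟩
  rfl

end EvenSuperderivations

/-! ### Gradings by an Euler field and the fields of positive even degree -/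

section EulerGradings

variable {A : Type*} [Ring A] [Algebra ℝ A]

/-- The operators that raise by `k` the degree given by the eigenvalues of `ε`. -/
def homogeneousOperators (ε : Module.End ℝ A) (k : ℝ) : Submodule ℝ (Module.End ℝ A) :=
  Module.End.eigenspace (LinearMap.mulLeft ℝ ε - LinearMap.mulRight ℝ ε) k

theorem mem_homogeneousOperators {ε X : Module.End ℝ A} {k : ℝ} :
    X ∈ homogeneousOperators ε k ↔ ε * X - X * ε = k • X := by
  rw [homogeneousOperators, Module.End.mem_eigenspace_iff]
  rfl

theorem homogeneousOperators_apply {ε X : Module.End ℝ A} {k : ℝ}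
    (hX : X ∈ homogeneousOperators ε k) {j : ℝ} {a : A} (ha : ε a = j • a) :
    ε (X a) = (j + k) • X a := by
  have := LinearMap.congr_fun (mem_homogeneousOperators.1 hX) a
  simp only [LinearMap.sub_apply, Module.End.mul_apply, LinearMap.smul_apply, ha, map_smul] at this
  rw [add_smul, ← this]
  abel

theorem commutator_mem_homogeneousOperators {ε X Y : Module.End ℝ A} {k l : ℝ}
    (hX : X ∈ homogeneousOperators ε k) (hY : Y ∈ homogeneousOperators ε l) :
    X * Y - Y * X ∈ homogeneousOperators ε (k + l) := by
  rw [mem_homogeneousOperators] at *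
  have h : ε * (X * Y - Y * X) - (X * Y - Y * X) * ε =
      (ε * X - X * ε) * Y + X * (ε * Y - Y * ε) - (ε * Y - Y * ε) * X - Y * (ε * X - X * ε) := by
    noncomm_ring
  rw [h, hX, hY]
  simp only [smul_mul_assoc, mul_smul_comm, smul_sub, add_smul]
  abel

/-- The operators in the sum of the `𝔤²ⁱ`, `i > 0`. -/
def positiveEvenFields (𝒜 : ZMod 2 → Submodule ℝ A) (ε : Module.End ℝ A) :
    Submodule ℝ (Module.End ℝ A) :=
  ⨆ i : {i : ℕ // 0 < i}, superDerAll 𝒜 ⊓ homogeneousOperators ε (2 * (i : ℕ))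

/-- An Euler field `ε` on a superalgebra: its eigenvalues, from `0` to `n`, grade the superalgebra
compatibly with the parity, the degrees `0` and `1` detect even superderivations, and in these
degrees there are enough evaluations and contractions. -/
structure IsEulerGrading (𝒜 : ZMod 2 → Submodule ℝ A) (ε : Module.End ℝ A) (n : ℕ) : Prop where
  mem : ε ∈ superDer 𝒜 0
  exists_proj : ∃ P : ℕ → Module.End ℝ A, (∑ j ∈ Finset.range (n + 1), P j = 1) ∧
    ∀ j, ε * P j = (j : ℝ) • P j ∧ P j * ε = (j : ℝ) • P j
  parity : ∀ (j : ℕ) (a : A), ε a = (j : ℝ) • a → a ∈ 𝒜 j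
  ext : ∀ X ∈ superDer 𝒜 0, (∀ a, ε a = 0 → X a = 0) → (∀ a, ε a = a → X a = 0) → X = 0
  commute_of_zero : ∀ h, ε h = 0 → ∀ a, h * a = a * h
  supercommute_of_one : ∀ β, ε β = β → ∀ q, ∀ a ∈ 𝒜 q, β * a = (-1 : ℝ) ^ q.val • (a * β)
  exists_eval : ∀ f, ε f = 0 → f ≠ 0 → ∃ ev : A →ₐ[ℝ] ℝ, ev f ≠ 0
  exists_contraction : ∀ γ, ε γ = γ → γ ≠ 0 → ∃ D ∈ superDer 𝒜 1,
    D ∈ homogeneousOperators ε (-1) ∧ ∃ ev : A →ₐ[ℝ] ℝ, ev (D γ) ≠ 0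

namespace IsEulerGrading

variable {𝒜 : ZMod 2 → Submodule ℝ A} {ε : Module.End ℝ A} {n : ℕ}

theorem eq_zero_of_forall_eigenvector (h : IsEulerGrading 𝒜 ε n) {X : Module.End ℝ A}
    (hX : ∀ (j : ℕ) (a : A), ε a = (j : ℝ) • a → X a = 0) : X = 0 := by
  obtain ⟨P, h1, h2⟩ := h.exists_proj
  rw [← mul_one X, ← h1, Finset.mul_sum]
  refine Finset.sum_eq_zero fun j _ => LinearMap.ext fun a => hX j (P j a) ?_
  exact LinearMap.congr_fun (h2 j).1 a

/-- Applying `P j` to `ε a = μ a` gives `(μ - j) P j a = 0`, and the `P j a` sum to `a`. -/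
theorem exists_nat_of_eigenvector (h : IsEulerGrading 𝒜 ε n) {a : A} {μ : ℝ} (ha : ε a = μ • a)
    (h0 : a ≠ 0) : ∃ j : ℕ, j ≤ n ∧ μ = j := by
  obtain ⟨P, h1, h2⟩ := h.exists_proj
  by_contra! hne
  apply h0
  have : a = (∑ j ∈ Finset.range (n + 1), P j) a := by rw [h1]; rfl
  rw [this, LinearMap.sum_apply]
  refine Finset.sum_eq_zero fun j hj => ?_
  have h3 := LinearMap.congr_fun (h2 j).2 a
  rw [Module.End.mul_apply, ha, map_smul, LinearMap.smul_apply, ← sub_eq_zero, ← sub_smul,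
    smul_eq_zero] at h3
  refine h3.resolve_left ?_
  exact sub_ne_zero.2 (hne j (Nat.lt_succ_iff.1 (Finset.mem_range.1 hj)))

/-- Every `X` is the finite sum of the blocks `P i * X * P j`, and such a block has degree `i - j`.
-/
theorem iSup_homogeneousOperators (h : IsEulerGrading 𝒜 ε n) :
    ⨆ μ, homogeneousOperators ε μ = ⊤ := by
  obtain ⟨P, h1, h2⟩ := h.exists_proj
  refine eq_top_iff.2 fun X _ => ?_
  have : X = ∑ i ∈ Finset.range (n + 1), ∑ j ∈ Finset.range (n + 1), P i * X * P j := by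
    rw [← Finset.sum_mul_sum, ← Finset.sum_mul, h1, one_mul, mul_one]
  rw [this]
  refine Submodule.sum_mem _ fun i _ => Submodule.sum_mem _ fun j _ => ?_
  refine Submodule.mem_iSup_of_mem ((i : ℝ) - j) (mem_homogeneousOperators.2 ?_)
  rw [mul_assoc _ (P j) ε, (h2 j).2, ← mul_assoc, ← mul_assoc, (h2 i).1]
  simp only [smul_mul_assoc, mul_smul_comm, sub_smul]

theorem le_iSup_homogeneous (h : IsEulerGrading 𝒜 ε n) {p : Submodule ℝ (Module.End ℝ A)}
    (hp : ∀ X ∈ p, ε * X - X * ε ∈ p) : p ≤ ⨆ μ, p ⊓ homogeneousOperators ε μ :=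
  le_iSup_inf_eigenspace (f := LinearMap.mulLeft ℝ ε - LinearMap.mulRight ℝ ε) hp
    (le_top.trans h.iSup_homogeneousOperators.ge)

theorem isNilpotent_of_mem_positiveEvenFields (h : IsEulerGrading 𝒜 ε n) {Y : Module.End ℝ A}
    (hY : Y ∈ positiveEvenFields 𝒜 ε) : IsNilpotent Y := by
  -- The filtration by degree at least `m`. As `Y` mixes several degrees, only the filtration is
  -- respected; `Y` moves it up at least one step, and it vanishes beyond `n`.
  let F : ℕ → Submodule ℝ A := fun m => ⨆ j : {j : ℕ // m ≤ j}, Module.End.eigenspace ε (j : ℕ)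
  have hF : ∀ m, F m ≤ (F (m + 1)).comap Y := by
    intro m
    unfold positiveEvenFields at hY
    induction hY using Submodule.iSup_induction' with
    | zero => intro a _; simp
    | add Y Y' _ _ h1 h2 =>
      intro a ha
      rw [Submodule.mem_comap, LinearMap.add_apply]
      exact add_mem (h1 ha) (h2 ha)
    | mem i Y hY =>
      refine iSup_le fun j a ha => ?_
      rw [Module.End.mem_eigenspace_iff] at ha
      have hj := j.2
      have hi := i.2
      refine Submodule.mem_iSup_of_mem ⟨j + 2 * i, by omega⟩ ?_
      rw [Module.End.mem_eigenspace_iff, homogeneousOperators_apply hY.2 ha]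
      push_cast
      rfl
  have hpow : ∀ m a, (Y ^ m) a ∈ F m := by
    intro m a
    induction m with
    | zero =>
      obtain ⟨P, h1, h2⟩ := h.exists_proj
      have : a = (∑ j ∈ Finset.range (n + 1), P j) a := by rw [h1]; rfl
      rw [pow_zero, this, Module.End.one_apply, LinearMap.sum_apply]
      refine Submodule.sum_mem _ fun j _ => Submodule.mem_iSup_of_mem ⟨j, Nat.zero_le j⟩ ?_
      exact Module.End.mem_eigenspace_iff.2 (LinearMap.congr_fun (h2 j).1 a)
    | succ m ih =>
      rw [pow_succ', Module.End.mul_apply]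
      exact hF m ih
  have hbot : F (n + 1) = ⊥ := by
    refine eq_bot_iff.2 (iSup_le fun j a ha => ?_)
    rw [Module.End.mem_eigenspace_iff] at ha
    by_contra h0
    obtain ⟨k, hk, e⟩ := h.exists_nat_of_eigenvector ha h0
    have hj := j.2
    rw [Nat.cast_inj] at e
    omega
  refine ⟨n + 1, LinearMap.ext fun a => ?_⟩
  have := hpow (n + 1) a
  rwa [hbot, Submodule.mem_bot] at this

variable [GradedAlgebra 𝒜]

/-- The degree of a nonzero even superderivation is even and not negative. -/
theorem exists_nat_of_homogeneous (h : IsEulerGrading 𝒜 ε n) {X : Module.End ℝ A}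
    (hX : X ∈ superDer 𝒜 0) {μ : ℝ} (hμ : X ∈ homogeneousOperators ε μ) (h0 : X ≠ 0) :
    ∃ i : ℕ, μ = 2 * i := by
  have key : ∀ j : ℕ, j ≤ 1 → ∀ a, ε a = (j : ℝ) • a → X a ≠ 0 → ∃ i : ℕ, μ = 2 * i := by
    intro j hj a ha hXa
    have e := homogeneousOperators_apply hμ ha
    obtain ⟨m, -, hm⟩ := h.exists_nat_of_eigenvector e hXa
    have p1 : X a ∈ 𝒜 m := h.parity m _ (by rw [e, hm])
    have p2 := (hX _ a (h.parity j a ha)).1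
    have p3 : (m : ZMod 2) = (j : ZMod 2) := by
      by_contra hne
      rw [zero_add] at p2
      exact hXa (eq_zero_of_mem_of_mem hne p1 p2)
    -- Since `m ≡ j` modulo 2 and `j ≤ 1`, the case `m < j` is impossible. This is what excludes
    -- negative degrees.
    rw [ZMod.natCast_eq_natCast_iff] at p3
    have p4 : m = 2 * (m / 2) + j := by
      unfold Nat.ModEq at p3
      omega
    refine ⟨m / 2, ?_⟩
    have p5 : (m : ℝ) = 2 * ((m / 2 : ℕ) : ℝ) + j := by exact_mod_cast p4
    linarith
  by_contra hcon
  refine h0 (h.ext X hX (fun a ha => ?_) fun a ha => ?_)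
  · by_contra hXa
    exact hcon (key 0 zero_le_one a (by simpa using ha) hXa)
  · by_contra hXa
    exact hcon (key 1 le_rfl a (by simpa using ha) hXa)

/-- The spaces `𝔤²ⁱ` are cut out of all of `𝔤`. On a homogeneous function the odd part of such a
field would produce a value of both parities, so it vanishes. -/
theorem mem_superDer_zero_of_even_degree (h : IsEulerGrading 𝒜 ε n) {X : Module.End ℝ A}
    (hX : X ∈ superDerAll 𝒜) {i : ℕ} (hi : X ∈ homogeneousOperators ε (2 * i)) :
    X ∈ superDer 𝒜 0 := by
  obtain ⟨X₀, h₀, X₁, h₁, rfl⟩ := Submodule.mem_sup.1 hX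
  have : X₁ = 0 := by
    refine h.eq_zero_of_forall_eigenvector fun j a ha => ?_
    have hp := h.parity j a ha
    have p1 := (h₁ _ a hp).1
    have p0 := (h₀ _ a hp).1
    rw [zero_add] at p0
    have e := homogeneousOperators_apply hi ha
    have p2 := h.parity (j + 2 * i) _ (by rw [e]; push_cast; rfl)
    have h2 : ((j + 2 * i : ℕ) : ZMod 2) = j := by
      push_cast
      rw [show (2 : ZMod 2) = 0 from rfl, zero_mul, add_zero]
    rw [h2, LinearMap.add_apply] at p2
    refine eq_zero_of_mem_of_mem (p := 1 + (j : ZMod 2)) (q := j) ?_ p1 ?_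
    · simp
    · simpa using sub_mem p2 p0
  rwa [this, add_zero]

theorem positiveEvenFields_le (h : IsEulerGrading 𝒜 ε n) :
    positiveEvenFields 𝒜 ε ≤ superDer 𝒜 0 :=
  iSup_le fun _ _ hX => h.mem_superDer_zero_of_even_degree hX.1 hX.2

/-- Degrees add under the commutator, and the components of `X` have degrees `2k ≥ 0`, so the
positive degrees of `Y` stay positive. -/
theorem commutator_mem_positiveEvenFields (h : IsEulerGrading 𝒜 ε n) {X Y : Module.End ℝ A}
    (hX : X ∈ superDer 𝒜 0) (hY : Y ∈ positiveEvenFields 𝒜 ε) :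
    X * Y - Y * X ∈ positiveEvenFields 𝒜 ε := by
  have hX' := h.le_iSup_homogeneous (fun X hX => commutator_mem_superDer_zero h.mem hX) hX
  clear hX
  induction hX' using Submodule.iSup_induction' with
  | zero => simp
  | add X X' _ _ h1 h2 =>
    rw [add_mul, mul_add, add_sub_add_comm]
    exact add_mem h1 h2
  | mem μ X hX =>
    by_cases h0 : X = 0
    · simp [h0]
    obtain ⟨k, rfl⟩ := h.exists_nat_of_homogeneous hX.1 hX.2 h0
    unfold positiveEvenFields at hY
    induction hY using Submodule.iSup_induction' with
    | zero => simp
    | add Y Y' _ _ h1 h2 =>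
      rw [add_mul, mul_add, add_sub_add_comm]
      exact add_mem h1 h2
    | mem i Y hY =>
      refine Submodule.mem_iSup_of_mem ⟨k + i, Nat.add_pos_right k i.2⟩ ⟨?_, ?_⟩
      · exact Submodule.mem_sup_left (commutator_mem_superDer_zero hX.1
          (h.mem_superDer_zero_of_even_degree hY.1 hY.2))
      · have := commutator_mem_homogeneousOperators hX.2 hY.2
        rw [← mul_add] at this
        exact_mod_cast this

end IsEulerGrading

end EulerGradings

/-! ### Ad-nilpotent ideals contain nothing of degree zero -/

section EulerGradingIdeals

variable {A : Type*} [Ring A] [Algebra ℝ A]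

namespace IsEulerGrading

variable {𝒜 : ZMod 2 → Submodule ℝ A} {ε : Module.End ℝ A} {n : ℕ} [GradedAlgebra 𝒜]

theorem mulLeft_mul_mem_superDer_zero (h : IsEulerGrading 𝒜 ε n) {f : A} (hf : ε f = 0)
    {X : Module.End ℝ A} (hX : X ∈ superDer 𝒜 0) : LinearMap.mulLeft ℝ f * X ∈ superDer 𝒜 0 := by
  intro q a ha
  have hf0 : f ∈ 𝒜 0 := by simpa using h.parity 0 f (by simpa using hf)
  refine ⟨?_, fun b => ?_⟩
  · have := SetLike.mul_mem_graded hf0 (hX q a ha).1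
    rwa [zero_add] at this
  · simp only [Module.End.mul_apply, LinearMap.mulLeft_apply, superDer_zero_apply_mul hX, mul_add,
      ZMod.val_zero, zero_mul, pow_zero, one_smul]
    rw [← mul_assoc, ← mul_assoc, ← mul_assoc, h.commute_of_zero f hf a]

/-- The sign from moving the odd `β` past `a` cancels the sign in the Leibniz rule of the odd `D`.
-/
theorem mulLeft_mul_mem_superDer_one (h : IsEulerGrading 𝒜 ε n) {β : A} (hβ : ε β = β)
    {D : Module.End ℝ A} (hD : D ∈ superDer 𝒜 1) : LinearMap.mulLeft ℝ β * D ∈ superDer 𝒜 0 := by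
  intro q a ha
  have hβ1 : β ∈ 𝒜 1 := by simpa using h.parity 1 β (by simpa using hβ)
  refine ⟨?_, fun b => ?_⟩
  · have := SetLike.mul_mem_graded hβ1 (hD q a ha).1
    rwa [← add_assoc] at this
  · simp only [Module.End.mul_apply, LinearMap.mulLeft_apply, superDer_one_apply_mul hD ha, mul_add,
      ZMod.val_zero, zero_mul, pow_zero, one_smul, mul_smul_comm]
    rw [← mul_assoc, ← mul_assoc, ← mul_assoc, h.supercommute_of_one β hβ q a ha, smul_mul_assoc,
      smul_smul, ← mul_pow]
    simp

variable {p : Submodule ℝ (Module.End ℝ A)}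

/-- An ad-nilpotent ideal contains no vector field with a nonzero symbol. -/
theorem apply_eq_zero_of_degree_zero (h : IsEulerGrading 𝒜 ε n) (hp : p ≤ superDer 𝒜 0)
    (hideal : ∀ X ∈ superDer 𝒜 0, ∀ Y ∈ p, X * Y - Y * X ∈ p)
    (hnil : ∀ Y ∈ p, IsAdNilpotent 𝒜 Y) {X : Module.End ℝ A} (hX : X ∈ p)
    (hX0 : X ∈ homogeneousOperators ε 0) {f : A} (hf : ε f = 0) : X f = 0 := by
  have hXd := hp hX
  have hker : ∀ {Y : Module.End ℝ A}, Y ∈ homogeneousOperators ε 0 → ∀ {a}, ε a = 0 →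
      ε (Y a) = 0 := by
    intro Y hY a ha
    have := homogeneousOperators_apply hY (j := 0) (a := a) (by simpa using ha)
    simpa using this
  have hmul : ∀ {a b : A}, ε a = 0 → ε b = 0 → ε (a * b) = 0 := by
    intro a b ha hb
    rw [superDer_zero_apply_mul h.mem, ha, hb, zero_mul, mul_zero, add_zero]
  by_contra hne
  obtain ⟨ev, hev⟩ := h.exists_eval _ (hker hX0 hf) hne
  -- Normalised to vanish at the point, so that `f₁²` vanishes there to second order.
  set f₁ : A := f - algebraMap ℝ A (ev f) with hf₁
  have hεf₁ : ε f₁ = 0 := by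
    rw [hf₁, map_sub, hf, superDer_zero_apply_algebraMap h.mem, sub_zero]
  have hXf₁ : X f₁ = X f := by
    rw [hf₁, map_sub, superDer_zero_apply_algebraMap hXd, sub_zero]
  have hevf₁ : ev f₁ = 0 := by
    rw [hf₁, map_sub, AlgHom.commutes]
    exact sub_self _
  set g : A := X (f₁ * f₁) with hg
  have hεg : ε g = 0 := hker hX0 (hmul hεf₁ hεf₁)
  have hevg : ev g = 0 := by
    rw [hg, superDer_zero_apply_mul hXd, map_add, map_mul, map_mul, hevf₁, mul_zero, zero_mul,
      add_zero]
  -- The value is `2 (ev (X f))²`: the terms that keep a factor `f₁` vanish.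
  have hevXg : ev (X g) ≠ 0 := by
    rw [hg, superDer_zero_apply_mul hXd, map_add, superDer_zero_apply_mul hXd,
      superDer_zero_apply_mul hXd, hXf₁]
    simp only [map_add, map_mul, hevf₁, mul_zero, zero_mul, zero_add, add_zero]
    intro h0
    apply hev
    nlinarith [mul_self_nonneg (ev (X f)), mul_self_eq_zero.1 (le_antisymm
      (by linarith) (mul_self_nonneg (ev (X f))))]
  have hZp : LinearMap.mulLeft ℝ g * X ∈ p := by
    have h1 := hideal _ (h.mulLeft_mul_mem_superDer_zero (hmul hεf₁ hεf₁) hXd) X hX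
    have h2 : LinearMap.mulLeft ℝ g * X = -(LinearMap.mulLeft ℝ (f₁ * f₁) * X * X -
        X * (LinearMap.mulLeft ℝ (f₁ * f₁) * X)) := by
      ext a
      simp only [LinearMap.neg_apply, LinearMap.sub_apply, Module.End.mul_apply,
        LinearMap.mulLeft_apply, superDer_zero_apply_mul hXd (f₁ * f₁)]
      rw [hg]
      abel
    rw [h2]
    exact neg_mem h1
  obtain ⟨m, hm⟩ := hnil _ hZp
  -- Here `[gX, kX] = (g X(k) - k X(g)) X`. As `g` vanishes at the point, the new coefficient has
  -- the value `-k X(g)` there, which is again nonzero.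
  have key : ∀ m : ℕ, ∃ k : A, ε k = 0 ∧ ev k ≠ 0 ∧
      (superBracket 𝒜 (LinearMap.mulLeft ℝ g * X))^[m] X = LinearMap.mulLeft ℝ k * X := by
    intro m
    induction m with
    | zero =>
      refine ⟨1, superDer_zero_apply_one h.mem, by simp, ?_⟩
      ext a
      simp
    | succ m ih =>
      obtain ⟨k, hk, hevk, e⟩ := ih
      refine ⟨g * X k - k * X g, ?_, ?_, ?_⟩
      · rw [map_sub, hmul hεg (hker hX0 hk), hmul hk (hker hX0 hεg), sub_zero]
      · rw [map_sub, map_mul, map_mul, hevg, zero_mul, zero_sub, neg_ne_zero]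
        exact mul_ne_zero hevk hevXg
      · rw [Function.iterate_succ_apply', e, superBracket_even 𝒜 (hp hZp)]
        ext a
        simp only [LinearMap.sub_apply, Module.End.mul_apply, LinearMap.mulLeft_apply,
          superDer_zero_apply_mul hXd, mul_add, sub_mul, ← mul_assoc]
        rw [h.commute_of_zero g hεg k]
        abel
  obtain ⟨k, -, hevk, e⟩ := key m
  rw [hm X (Submodule.mem_sup_left hXd)] at e
  have h1 := congrArg ev (LinearMap.congr_fun e f)
  simp only [LinearMap.zero_apply, Module.End.mul_apply, LinearMap.mulLeft_apply, map_mul,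
    map_zero] at h1
  exact mul_ne_zero hevk hev h1.symm

/-- The elements of degree zero of an ad-nilpotent ideal are nilpotent endomorphisms of the
functions of degree one. -/
theorem exists_pow_apply_eq_zero (h : IsEulerGrading 𝒜 ε n) {X : Module.End ℝ A}
    (hXd : X ∈ superDer 𝒜 0) (hnil : IsAdNilpotent 𝒜 X) (hX0 : X ∈ homogeneousOperators ε 0)
    (hXf : ∀ f, ε f = 0 → X f = 0) : ∃ m : ℕ, ∀ β, ε β = β → (X ^ m) β = 0 := by
  obtain ⟨m, hm⟩ := hnil
  refine ⟨m, fun β hβ => ?_⟩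
  have hX1 : ∀ {a}, ε a = a → ε (X a) = X a := by
    intro a ha
    simpa using homogeneousOperators_apply hX0 (j := 1) (a := a) (by simpa using ha)
  have hpow : ∀ (k : ℕ) {a}, ε a = a → ε ((X ^ k) a) = (X ^ k) a := by
    intro k
    induction k with
    | zero => intro a ha; simpa using ha
    | succ k ih =>
      intro a ha
      rw [pow_succ, Module.End.mul_apply]
      exact ih (hX1 ha)
  by_contra hne
  obtain ⟨D, hD, hDε, ev, hev⟩ := h.exists_contraction _ (hpow m hβ) hne
  have hDf : ∀ {a}, ε a = a → ε (D a) = 0 := by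
    intro a ha
    simpa using homogeneousOperators_apply hDε (j := 1) (a := a) (by simpa using ha)
  -- `D` takes degree 1 to degree 0, which `X` kills. Only the term with every `X` to the right of
  -- `D` survives.
  have key : ∀ (m : ℕ) (a : A), ε a = a →
      ((superBracket 𝒜 X)^[m] D) a = (-1 : ℝ) ^ m • D ((X ^ m) a) := by
    intro m
    induction m with
    | zero => intro a _; simp
    | succ m ih =>
      intro a ha
      rw [Function.iterate_succ_apply', superBracket_even 𝒜 hXd, LinearMap.sub_apply,
        Module.End.mul_apply, Module.End.mul_apply, ih a ha, ih (X a) (hX1 ha), map_smul,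
        hXf _ (hDf (hpow m ha)), pow_succ X, Module.End.mul_apply, pow_succ]
      simp
  have h1 := key m β hβ
  rw [hm D (Submodule.mem_sup_right hD), LinearMap.zero_apply, eq_comm, smul_eq_zero] at h1
  rcases h1 with h1 | h1
  · exact pow_ne_zero m (by norm_num) h1
  · rw [h1, map_zero] at hev
    exact hev rfl

/-- With zero symbol, `X` acts on degree 1 as a nilpotent bundle endomorphism. Bracketing it with a
suitable rank-one endomorphism `αD` yields an element of the ideal with a nonzero eigenvalue at a
point. -/
theorem eq_zero_of_mem_adNilpotent_of_degree_zero (h : IsEulerGrading 𝒜 ε n)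
    (hp : p ≤ superDer 𝒜 0) (hideal : ∀ X ∈ superDer 𝒜 0, ∀ Y ∈ p, X * Y - Y * X ∈ p)
    (hnil : ∀ Y ∈ p, IsAdNilpotent 𝒜 Y) {X : Module.End ℝ A} (hX : X ∈ p)
    (hX0 : X ∈ homogeneousOperators ε 0) : X = 0 := by
  have hXd := hp hX
  have hXf := fun f hf => h.apply_eq_zero_of_degree_zero hp hideal hnil hX hX0 (f := f) hf
  refine h.ext X hXd hXf fun β hβ => ?_
  by_contra hne
  have hX1 : ∀ {a}, ε a = a → ε (X a) = X a := by
    intro a ha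
    simpa using homogeneousOperators_apply hX0 (j := 1) (a := a) (by simpa using ha)
  -- Otherwise no power of `X` would kill `β`, contrary to nilpotency on degree 1.
  have hex : ∃ α, ε α = α ∧ X α ≠ 0 ∧ X (X α) = 0 := by
    obtain ⟨m, hm⟩ := h.exists_pow_apply_eq_zero hXd (hnil X hX) hX0 hXf
    by_contra! hcon
    have : ∀ k : ℕ, ε ((X ^ k) β) = (X ^ k) β ∧ X ((X ^ k) β) ≠ 0 := by
      intro k
      induction k with
      | zero => exact ⟨by simpa using hβ, by simpa using hne⟩
      | succ k ih =>
        rw [pow_succ', Module.End.mul_apply]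
        exact ⟨hX1 ih.1, hcon _ ih.1 ih.2⟩
    apply (this m).2
    rw [hm β hβ, map_zero]
  obtain ⟨α, hα, hγ, hXγ⟩ := hex
  set γ := X α with hγdef
  have hεγ : ε γ = γ := hX1 hα
  obtain ⟨D, hD, hDε, ev, hev⟩ := h.exists_contraction γ hεγ hγ
  set g := D γ with hg
  have hεg : ε g = 0 := by
    simpa using homogeneousOperators_apply hDε (j := 1) (a := γ) (by simpa using hεγ)
  have hZ0 : LinearMap.mulLeft ℝ α * D ∈ homogeneousOperators ε 0 := by
    rw [mem_homogeneousOperators] at hDε ⊢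
    ext a
    have h1 := LinearMap.congr_fun hDε a
    simp only [LinearMap.sub_apply, Module.End.mul_apply, LinearMap.smul_apply,
      LinearMap.mulLeft_apply, superDer_zero_apply_mul h.mem, hα] at h1 ⊢
    rw [add_sub_assoc, ← mul_sub, h1]
    simp
  have hZd := h.mulLeft_mul_mem_superDer_one hα hD
  have hB := hideal _ hZd X hX
  have hB0 : LinearMap.mulLeft ℝ α * D * X - X * (LinearMap.mulLeft ℝ α * D) ∈
      homogeneousOperators ε 0 := by
    simpa using commutator_mem_homogeneousOperators hZ0 hX0
  set B := LinearMap.mulLeft ℝ α * D * X - X * (LinearMap.mulLeft ℝ α * D) with hBdef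
  have hBf := fun f hf => h.apply_eq_zero_of_degree_zero hp hideal hnil hB hB0 (f := f) hf
  -- `αD(Xγ) = 0` because `Xγ = 0`, and `X(αg) = γg` because `X` kills `g`.
  have hBγ : B γ = -(g * γ) := by
    simp only [hBdef, LinearMap.sub_apply, Module.End.mul_apply, LinearMap.mulLeft_apply, hXγ,
      map_zero, mul_zero, zero_sub, ← hg, superDer_zero_apply_mul hXd, hXf g hεg, add_zero,
      ← hγdef, h.commute_of_zero g hεg γ]
  have hgpow : ∀ k : ℕ, ε (g ^ k) = 0 := by
    intro k
    induction k with
    | zero => simpa using superDer_zero_apply_one h.mem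
    | succ k ih => rw [pow_succ, superDer_zero_apply_mul h.mem, ih, hεg, zero_mul, mul_zero,
        add_zero]
  have hBpow : ∀ k : ℕ, (B ^ k) γ = (-1 : ℝ) ^ k • (g ^ k * γ) := by
    intro k
    induction k with
    | zero => simp
    | succ k ih =>
      rw [pow_succ', Module.End.mul_apply, ih, map_smul, superDer_zero_apply_mul (hp hB),
        hBf _ (hgpow k), zero_mul, zero_add, hBγ, pow_succ (-1 : ℝ), pow_succ g]
      simp [mul_assoc]
  obtain ⟨m, hm⟩ := h.exists_pow_apply_eq_zero (hp hB) (hnil B hB) hB0 hBf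
  have h1 := hm γ hεγ
  rw [hBpow, smul_eq_zero] at h1
  have h2 : g ^ m * γ = 0 := h1.resolve_left (pow_ne_zero m (by norm_num))
  have hg0 : ∀ k : ℕ, g ^ k ∈ 𝒜 0 := fun k => by
    simpa using h.parity 0 (g ^ k) (by simpa using hgpow k)
  -- The value would have degree -1, which is not an eigenvalue of `ε`.
  have hDpow : ∀ k : ℕ, D (g ^ k) = 0 := by
    intro k
    by_contra h0
    obtain ⟨j, -, hj⟩ := h.exists_nat_of_eigenvector
      (homogeneousOperators_apply hDε (j := 0) (a := g ^ k) (by simpa using hgpow k)) h0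
    have : (0 : ℝ) ≤ (j : ℝ) := Nat.cast_nonneg j
    linarith
  -- Contracting `g^m γ = 0` with `D` leaves `g^m * g = 0`, but `g` is nonzero at the point `ev`.
  have h3 := congrArg D h2
  rw [superDer_one_apply_mul hD (hg0 m), hDpow, zero_mul, zero_add, map_zero, ← hg] at h3
  have h4 := congrArg ev h3
  simp only [ZMod.val_zero, pow_zero, one_smul, map_mul, map_pow, map_zero] at h4
  exact mul_ne_zero (pow_ne_zero m hev) hev h4

theorem le_positiveEvenFields (h : IsEulerGrading 𝒜 ε n) (hp : p ≤ superDer 𝒜 0)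
    (hideal : ∀ X ∈ superDer 𝒜 0, ∀ Y ∈ p, X * Y - Y * X ∈ p)
    (hnil : ∀ Y ∈ p, IsAdNilpotent 𝒜 Y) : p ≤ positiveEvenFields 𝒜 ε := by
  refine (h.le_iSup_homogeneous (hideal ε h.mem)).trans (iSup_le fun μ X hX => ?_)
  by_cases h0 : X = 0
  · rw [h0]
    exact zero_mem _
  obtain ⟨i, rfl⟩ := h.exists_nat_of_homogeneous (hp hX.1) hX.2 h0
  have hi : 0 < i := by
    rw [Nat.pos_iff_ne_zero]
    rintro rfl
    exact h0 (h.eq_zero_of_mem_adNilpotent_of_degree_zero hp hideal hnil hX.1 (by simpa using hX.2))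
  exact Submodule.mem_iSup_of_mem ⟨i, hi⟩ ⟨Submodule.mem_sup_left (hp hX.1), hX.2⟩

/-- The largest ideal of ad-nilpotent even superderivations. -/
theorem exists_isGreatest_adNilpotentIdeals (h : IsEulerGrading 𝒜 ε n) :
    ∃ J : LieIdeal ℝ (evenDer 𝒜), IsGreatest (adNilpotentIdeals 𝒜) J ∧
      J.toSubmodule.map (evenDer 𝒜).toSubmodule.subtype = positiveEvenFields 𝒜 ε := by
  let J : LieIdeal ℝ (evenDer 𝒜) :=
    { (positiveEvenFields 𝒜 ε).comap (evenDer 𝒜).toSubmodule.subtype with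
      lie_mem := fun {X Y} hY => h.commutator_mem_positiveEvenFields X.2 hY }
  have hmem : ∀ X : evenDer 𝒜, X ∈ J ↔ (X : Module.End ℝ A) ∈ positiveEvenFields 𝒜 ε :=
    fun X => Iff.rfl
  refine ⟨J, ⟨fun X hX => ?_, fun J' hJ' X hX => ?_⟩, ?_⟩
  · exact isAdNilpotent_of_isNilpotent X.2 (h.isNilpotent_of_mem_positiveEvenFields hX)
  · rw [hmem]
    refine h.le_positiveEvenFields (p := J'.toSubmodule.map (evenDer 𝒜).toSubmodule.subtype)
      ?_ (fun Y hY Z hZ => commutator_mem_of_mem_ideal hY hZ) ?_ ⟨X, hX, rfl⟩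
    · rintro _ ⟨Y, -, rfl⟩
      exact Y.2
    · rintro _ ⟨Y, hY, rfl⟩
      exact hJ' Y hY
  · ext X
    refine ⟨?_, fun hX => ⟨⟨X, h.positiveEvenFields_le hX⟩, hX, rfl⟩⟩
    rintro ⟨Y, hY, rfl⟩
    exact hY

/-- A maximal element of a set with a greatest element is that greatest element. Maximality of `J`
does not refer to `ε`, which gives the independence of the splitting. -/
theorem map_eq_positiveEvenFields (h : IsEulerGrading 𝒜 ε n) {J : LieIdeal ℝ (evenDer 𝒜)}
    (hJ : Maximal (· ∈ adNilpotentIdeals 𝒜) J) :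
    J.toSubmodule.map (evenDer 𝒜).toSubmodule.subtype = positiveEvenFields 𝒜 ε := by
  obtain ⟨J₀, h1, h2⟩ := h.exists_isGreatest_adNilpotentIdeals
  rw [← h2, le_antisymm (h1.2 hJ.1) (hJ.2 h1.1 (h1.2 hJ.1))]

end IsEulerGrading

end EulerGradingIdeals

/-! ### Contraction, degree and projections on an exterior algebra -/

section ExteriorAlgebraOperators

open CliffordAlgebra (contractLeft involute)

variable {E : Type*} [AddCommGroup E] [Module ℝ E]

/-- The contraction with `d` as an operator on the exterior algebra. -/
noncomputable abbrev exteriorContract (d : Module.Dual ℝ E) : Module.End ℝ (ExteriorAlgebra ℝ E) :=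
  contractLeft (Q := (0 : QuadraticForm ℝ E)) d

/-- The grade involution carries the sign of the odd Leibniz rule, so `a` need not be homogeneous
and induction on its factors applies. -/
theorem exteriorContract_mul (d : Module.Dual ℝ E) (a b : ExteriorAlgebra ℝ E) :
    exteriorContract d (a * b) = exteriorContract d a * b + involute a * exteriorContract d b := by
  induction a using CliffordAlgebra.left_induction with
  | algebraMap r => simp [CliffordAlgebra.contractLeft_algebraMap_mul]
  | add x y hx hy =>
    simp only [add_mul, map_add, hx, hy]
    abel
  | ι_mul x m hx =>
    rw [mul_assoc, CliffordAlgebra.contractLeft_ι_mul, CliffordAlgebra.contractLeft_ι_mul, hx,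
      map_mul, CliffordAlgebra.involute_ι]
    simp only [mul_add, sub_mul, smul_mul_assoc, neg_mul, mul_assoc]
    abel

theorem exteriorDegree_algebraMap (c : ℝ) : exteriorDegree E (algebraMap ℝ _ c) = 0 := by
  rw [exteriorDegree_of_mem (k := 0) (SetLike.algebraMap_mem_graded _ c)]
  simp

theorem exteriorDegree_ι (v : E) :
    exteriorDegree E (ExteriorAlgebra.ι ℝ v) = ExteriorAlgebra.ι ℝ v := by
  rw [exteriorDegree_of_mem (k := 1) (by simp)]
  simp

theorem exteriorDegree_exteriorContract (d : Module.Dual ℝ E) (a : ExteriorAlgebra ℝ E) :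
    exteriorDegree E (exteriorContract d a) =
      exteriorContract d (exteriorDegree E a) - exteriorContract d a := by
  induction a using CliffordAlgebra.left_induction with
  | algebraMap r =>
    rw [exteriorDegree_algebraMap, CliffordAlgebra.contractLeft_algebraMap]
    simp
  | add x y hx hy =>
    simp only [map_add, hx, hy]
    abel
  | ι_mul x m hx =>
    have h1 : exteriorDegree E (CliffordAlgebra.ι 0 m * x) =
        CliffordAlgebra.ι 0 m * x + CliffordAlgebra.ι 0 m * exteriorDegree E x := by
      rw [exteriorDegree_mul]
      congr 2
      exact exteriorDegree_ι m
    have h2 : exteriorDegree E (CliffordAlgebra.ι 0 m * exteriorContract d x) =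
        CliffordAlgebra.ι 0 m * exteriorContract d x +
          CliffordAlgebra.ι 0 m * exteriorDegree E (exteriorContract d x) := by
      rw [exteriorDegree_mul]
      congr 2
      exact exteriorDegree_ι m
    rw [h1, map_add, CliffordAlgebra.contractLeft_ι_mul, CliffordAlgebra.contractLeft_ι_mul,
      map_sub, h2, map_smul, hx, mul_sub]
    abel

theorem involute_of_mem_exteriorParity {q : ZMod 2} {a : ExteriorAlgebra ℝ E}
    (ha : a ∈ exteriorParity E q) : involute a = (-1 : ℝ) ^ q.val • a := by
  have e : ∀ q : ZMod 2, q = 0 ∨ q = 1 := by decide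
  rcases e q with rfl | rfl
  · rw [CliffordAlgebra.involute_eq_of_mem_even ha]
    simp
  · rw [CliffordAlgebra.involute_eq_of_mem_odd ha]
    simp [ZMod.val_one]

theorem mem_exteriorParity_of_mem {k : ℕ} {a : ExteriorAlgebra ℝ E} (ha : a ∈ ⋀[ℝ]^k E) :
    a ∈ exteriorParity E k :=
  Submodule.mem_iSup_of_mem (p := fun j : {n : ℕ // (n : ZMod 2) = k} =>
    LinearMap.range (CliffordAlgebra.ι (0 : QuadraticForm ℝ E)) ^ (j : ℕ)) ⟨k, rfl⟩ ha

theorem exists_algebraMap_eq_of_mem {a : ExteriorAlgebra ℝ E} (ha : a ∈ ⋀[ℝ]^0 E) :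
    ∃ c : ℝ, algebraMap ℝ _ c = a := by
  change a ∈ LinearMap.range (ExteriorAlgebra.ι ℝ : E →ₗ[ℝ] _) ^ 0 at ha
  rwa [pow_zero, Submodule.mem_one] at ha

theorem exists_ι_eq_of_mem {a : ExteriorAlgebra ℝ E} (ha : a ∈ ⋀[ℝ]^1 E) :
    ∃ v : E, ExteriorAlgebra.ι ℝ v = a := by
  change a ∈ LinearMap.range (ExteriorAlgebra.ι ℝ : E →ₗ[ℝ] _) ^ 1 at ha
  rwa [pow_one] at ha

theorem exteriorContract_mem_exteriorParity (d : Module.Dual ℝ E) {q : ZMod 2}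
    {a : ExteriorAlgebra ℝ E} (ha : a ∈ exteriorParity E q) :
    exteriorContract d a ∈ exteriorParity E (1 + q) := by
  have : exteriorParity E q ≤ (exteriorParity E (1 + q)).comap (exteriorContract d) := by
    refine iSup_le fun j b hb => ?_
    obtain ⟨j, rfl⟩ := j
    rw [Submodule.mem_comap]
    have hb' : b ∈ ⋀[ℝ]^j E := hb
    cases j with
    | zero =>
      obtain ⟨c, rfl⟩ := exists_algebraMap_eq_of_mem hb'
      rw [CliffordAlgebra.contractLeft_algebraMap]
      exact zero_mem _
    | succ j =>
      have h1 : exteriorContract d b ∈ ⋀[ℝ]^j E := by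
        rw [← exteriorDegree_eq_iff, exteriorDegree_exteriorContract, exteriorDegree_of_mem hb',
          map_smul]
        push_cast
        rw [add_smul, one_smul, add_sub_cancel_right]
      have h2 := mem_exteriorParity_of_mem h1
      have h3 : (1 + ((j + 1 : ℕ) : ZMod 2)) = j := by
        push_cast
        rw [add_comm, add_assoc, show (1 + 1 : ZMod 2) = 0 from rfl, add_zero]
      rwa [h3]
  exact this ha

theorem ι_mul_eq_involute_mul_ι (v : E) (a : ExteriorAlgebra ℝ E) :
    ExteriorAlgebra.ι ℝ v * a = involute a * ExteriorAlgebra.ι ℝ v := by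
  induction a using CliffordAlgebra.left_induction with
  | algebraMap r =>
    rw [AlgHom.commutes]
    exact (Algebra.commutes r _).symm
  | add x y hx hy => rw [mul_add, map_add, add_mul, hx, hy]
  | ι_mul x m hx =>
    rw [map_mul, CliffordAlgebra.involute_ι, mul_assoc, ← hx, ← mul_assoc, neg_mul, ← mul_assoc,
      ← neg_mul]
    congr 1
    exact eq_neg_of_add_eq_zero_left (ExteriorAlgebra.ι_add_mul_swap v m)

/-- The projection of the exterior algebra onto `Λᵏ E`. -/
noncomputable abbrev exteriorProj (E : Type*) [AddCommGroup E] [Module ℝ E] (k : ℕ) :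
    Module.End ℝ (ExteriorAlgebra ℝ E) :=
  GradedAlgebra.proj (fun k : ℕ => ⋀[ℝ]^k E) k

theorem exteriorProj_mem (k : ℕ) (a : ExteriorAlgebra ℝ E) : exteriorProj E k a ∈ ⋀[ℝ]^k E :=
  SetLike.coe_mem (DirectSum.decompose (fun k : ℕ => ⋀[ℝ]^k E) a k)

theorem exteriorProj_of_mem {j : ℕ} {a : ExteriorAlgebra ℝ E} (ha : a ∈ ⋀[ℝ]^j E) (k : ℕ) :
    exteriorProj E k a = if j = k then a else 0 := by
  split_ifs with h
  · subst h
    exact DirectSum.decompose_of_mem_same (fun k : ℕ => ⋀[ℝ]^k E) ha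
  · exact DirectSum.decompose_of_mem_ne (fun k : ℕ => ⋀[ℝ]^k E) ha h

theorem exteriorDegree_exteriorProj (k : ℕ) (a : ExteriorAlgebra ℝ E) :
    exteriorDegree E (exteriorProj E k a) = (k : ℝ) • exteriorProj E k a :=
  exteriorDegree_of_mem (exteriorProj_mem k a)

theorem exteriorProj_exteriorDegree (k : ℕ) (a : ExteriorAlgebra ℝ E) :
    exteriorProj E k (exteriorDegree E a) = (k : ℝ) • exteriorProj E k a := by
  induction a using DirectSum.Decomposition.inductionOn (fun k : ℕ => ⋀[ℝ]^k E) with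
  | zero => simp
  | add b b' hb hb' => simp only [map_add, hb, hb', smul_add]
  | @homogeneous i b =>
    rw [exteriorDegree_of_mem b.2, map_smul, exteriorProj_of_mem b.2]
    split_ifs with h
    · subst h
      rfl
    · simp

theorem exteriorProj_mul (k : ℕ) (a b : ExteriorAlgebra ℝ E) :
    exteriorProj E k (a * b) = ∑ ij ∈ Finset.HasAntidiagonal.antidiagonal k,
      exteriorProj E ij.1 a * exteriorProj E ij.2 b := by
  classical
  have := DirectSum.coe_mul_apply_eq_sum_antidiagonal (fun k : ℕ => ⋀[ℝ]^k E)
    (DirectSum.decompose (fun k : ℕ => ⋀[ℝ]^k E) a) (DirectSum.decompose (fun k : ℕ => ⋀[ℝ]^k E) b)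
    k
  rwa [← DirectSum.decompose_mul] at this

theorem eq_zero_of_mem_of_finrank_lt [FiniteDimensional ℝ E] {k : ℕ}
    (hk : Module.finrank ℝ E < k) {a : ExteriorAlgebra ℝ E} (ha : a ∈ ⋀[ℝ]^k E) : a = 0 := by
  have h : Module.finrank ℝ (⋀[ℝ]^k E) = 0 := by
    rw [exteriorPower.finrank_eq, Nat.choose_eq_zero_of_lt hk]
  rw [Module.finrank_zero_iff] at h
  exact congrArg Subtype.val (Subsingleton.elim (⟨a, ha⟩ : ⋀[ℝ]^k E) 0)

theorem sum_exteriorProj [FiniteDimensional ℝ E] (a : ExteriorAlgebra ℝ E) :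
    ∑ k ∈ Finset.range (Module.finrank ℝ E + 1), exteriorProj E k a = a := by
  classical
  conv_rhs => rw [← DirectSum.sum_support_decompose (fun k : ℕ => ⋀[ℝ]^k E) a]
  symm
  refine Finset.sum_subset (fun k hk => ?_) fun k _ hk => ?_
  · by_contra hlt
    rw [Finset.mem_range, Nat.lt_succ_iff, not_le] at hlt
    rw [DFinsupp.mem_support_iff] at hk
    exact hk (Subtype.ext (eq_zero_of_mem_of_finrank_lt hlt (SetLike.coe_mem _)))
  · rw [DFinsupp.notMem_support_iff] at hk
    rw [hk]
    rfl

end ExteriorAlgebraOperators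

/-! ### Fibrewise operators on smooth sections -/

section SectionOperators

open CliffordAlgebra (involute)

variable (s : ℕ) {M : Type u} [TopologicalSpace M] [ChartedSpace (EuclideanSpace ℝ (Fin s)) M]
  (F : Type*) [NormedAddCommGroup F] [NormedSpace ℝ F]
  (V : M → Type*) [∀ x, AddCommGroup (V x)] [∀ x, Module ℝ (V x)] [∀ x, TopologicalSpace (V x)]
  [TopologicalSpace (TotalSpace F V)] [FiberBundle F V]

/-- The operator on `Γ(Λ• V*)` given by operators on the fibers that preserve the sums of products
of smooth functions and smooth sections of `V*`. -/
noncomputable def sectionsOperator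
    (T : ∀ x, Module.End ℝ (ExteriorAlgebra ℝ (Module.Dual ℝ (V x))))
    (hT : ∀ η ∈ Algebra.adjoin ℝ (exteriorGenerators s F V),
      (fun x => T x (η x)) ∈ Algebra.adjoin ℝ (exteriorGenerators s F V)) :
    Module.End ℝ (exteriorSections s F V) where
  toFun θ := ⟨fun x => T x (θ.1 x), fun x₀ => by
    obtain ⟨η, hη, e⟩ := θ.2 x₀
    refine ⟨_, hT η hη, ?_⟩
    filter_upwards [e] with x hx
    rw [hx]⟩
  map_add' θ θ' := Subtype.ext (funext fun x => by simp)
  map_smul' c θ := Subtype.ext (funext fun x => by simp)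

theorem mem_exteriorSections_of_mem_adjoin
    {η : ∀ x, ExteriorAlgebra ℝ (Module.Dual ℝ (V x))}
    (hη : η ∈ Algebra.adjoin ℝ (exteriorGenerators s F V)) : η ∈ exteriorSections s F V :=
  fun _ => ⟨η, hη, Filter.Eventually.of_forall fun _ => rfl⟩

variable {s F V}

theorem involute_mem_adjoin {η : ∀ x, ExteriorAlgebra ℝ (Module.Dual ℝ (V x))}
    (hη : η ∈ Algebra.adjoin ℝ (exteriorGenerators s F V)) :
    (fun x => involute (η x)) ∈ Algebra.adjoin ℝ (exteriorGenerators s F V) := by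
  induction hη using Algebra.adjoin_induction with
  | mem η h =>
    rcases h with ⟨f, rfl⟩ | ⟨α, hα, rfl⟩
    · simp only [AlgHom.commutes]
      exact Algebra.subset_adjoin (Or.inl ⟨f, rfl⟩)
    · simp only [CliffordAlgebra.involute_ι]
      exact Subalgebra.neg_mem _ (Algebra.subset_adjoin (Or.inr ⟨α, hα, rfl⟩))
  | algebraMap c =>
    simp only [Pi.algebraMap_apply, AlgHom.commutes]
    exact Subalgebra.algebraMap_mem _ c
  | add η η' _ _ h h' =>
    simp only [Pi.add_apply, map_add]
    exact add_mem h h'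
  | mul η η' _ _ h h' =>
    simp only [Pi.mul_apply, map_mul]
    exact mul_mem h h'

/-- On a section `α` of `V*` the contraction is the pairing `α(σ)`, smooth by the definition of
`IsSmoothDualSection`; the Leibniz rule propagates this to products. -/
theorem exteriorContract_mem_adjoin {σ : ∀ x, V x}
    (hσ : ContMDiff (𝓡 s) ((𝓡 s).prod 𝓘(ℝ, F)) ∞ (fun x => TotalSpace.mk' F x (σ x)))
    {η : ∀ x, ExteriorAlgebra ℝ (Module.Dual ℝ (V x))}
    (hη : η ∈ Algebra.adjoin ℝ (exteriorGenerators s F V)) :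
    (fun x => exteriorContract (Module.Dual.eval ℝ (V x) (σ x)) (η x)) ∈
      Algebra.adjoin ℝ (exteriorGenerators s F V) := by
  induction hη using Algebra.adjoin_induction with
  | mem η h =>
    rcases h with ⟨f, rfl⟩ | ⟨α, hα, rfl⟩
    · simp only [CliffordAlgebra.contractLeft_algebraMap]
      exact zero_mem _
    · simp only [CliffordAlgebra.contractLeft_ι, Module.Dual.eval_apply]
      exact Algebra.subset_adjoin (Or.inl
        ⟨⟨fun x => α x (σ x), contMDiffOn_univ.1 (hα _ σ isOpen_univ hσ.contMDiffOn)⟩, rfl⟩)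
  | algebraMap c =>
    simp only [Pi.algebraMap_apply, CliffordAlgebra.contractLeft_algebraMap]
    exact zero_mem _
  | add η η' _ _ h h' =>
    simp only [Pi.add_apply, map_add]
    exact add_mem h h'
  | mul η η' hη hη' h h' =>
    simp only [Pi.mul_apply, exteriorContract_mul]
    exact add_mem (mul_mem h hη') (mul_mem (involute_mem_adjoin hη) h')

/-- The induction runs over all `k` at once, since a component of a product involves all lower
components of its factors. -/
theorem exteriorProj_mem_adjoin (k : ℕ) {η : ∀ x, ExteriorAlgebra ℝ (Module.Dual ℝ (V x))}
    (hη : η ∈ Algebra.adjoin ℝ (exteriorGenerators s F V)) :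
    (fun x => exteriorProj _ k (η x)) ∈ Algebra.adjoin ℝ (exteriorGenerators s F V) := by
  induction hη using Algebra.adjoin_induction generalizing k with
  | mem η h =>
    rcases h with ⟨f, rfl⟩ | ⟨α, hα, rfl⟩
    · simp only [exteriorProj_of_mem (SetLike.algebraMap_mem_graded _ _)]
      split_ifs
      · exact Algebra.subset_adjoin (Or.inl ⟨f, rfl⟩)
      · exact zero_mem _
    · have h1 : ∀ x, ExteriorAlgebra.ι ℝ (α x) ∈ ⋀[ℝ]^1 (Module.Dual ℝ (V x)) := fun x => by simp
      simp only [exteriorProj_of_mem (h1 _)]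
      split_ifs
      · exact Algebra.subset_adjoin (Or.inr ⟨α, hα, rfl⟩)
      · exact zero_mem _
  | algebraMap c =>
    simp only [Pi.algebraMap_apply, exteriorProj_of_mem (SetLike.algebraMap_mem_graded _ _)]
    split_ifs
    · exact Subalgebra.algebraMap_mem _ c
    · exact zero_mem _
  | add η η' _ _ h h' =>
    simp only [Pi.add_apply, map_add]
    exact add_mem (h k) (h' k)
  | mul η η' hη hη' h h' =>
    simp only [Pi.mul_apply, exteriorProj_mul]
    have : (fun x => ∑ ij ∈ Finset.HasAntidiagonal.antidiagonal k,
        exteriorProj (Module.Dual ℝ (V x)) ij.1 (η x) * exteriorProj _ ij.2 (η' x)) =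
        ∑ ij ∈ Finset.HasAntidiagonal.antidiagonal k,
          (fun x => exteriorProj (Module.Dual ℝ (V x)) ij.1 (η x)) *
            (fun x => exteriorProj (Module.Dual ℝ (V x)) ij.2 (η' x)) := by
      ext x
      simp only [Finset.sum_apply, Pi.mul_apply]
    rw [this]
    exact sum_mem fun ij _ => mul_mem (h ij.1) (h' ij.2)

variable (s F V)

/-- Every vector in a fiber is the value of a smooth section. -/
theorem exists_contMDiff_section_eq [T2Space M] [IsManifold (𝓡 s) ∞ M] [VectorBundle ℝ F V]
    [ContMDiffVectorBundle ∞ F V (𝓡 s)] {x₀ : M} (v : V x₀) :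
    ∃ σ : ∀ x, V x, σ x₀ = v ∧
      ContMDiff (𝓡 s) ((𝓡 s).prod 𝓘(ℝ, F)) ∞ (fun x => TotalSpace.mk' F x (σ x)) := by
  obtain ⟨u, hu, hσ⟩ := FiberBundle.exists_contMDiffOn_extend (k := ∞) (𝓡 s) F v
  obtain ⟨u', hu', huo, hx⟩ := mem_nhds_iff.1 hu
  obtain ⟨f, -, hf⟩ := (SmoothBumpFunction.nhds_basis_tsupport (I := 𝓡 s) x₀).mem_iff.1
    (huo.mem_nhds hx)
  refine ⟨(f : M → ℝ) • FiberBundle.extend F v, ?_, ?_⟩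
  · rw [Pi.smul_apply', f.eq_one, one_smul, FiberBundle.extend_apply_self]
  · exact ContMDiffOn.smul_section_of_tsupport f.contMDiff.contMDiffOn huo hf (hσ.mono hu')

/-- Gives one bound on the exterior degree for all points, hence a finite set of projections. -/
theorem finrank_dual_fiber [VectorBundle ℝ F V] (x : M) :
    Module.finrank ℝ (Module.Dual ℝ (V x)) = Module.finrank ℝ F := by
  rw [Subspace.dual_finrank_eq]
  exact (((trivializationAt F V x).continuousLinearEquivAt ℝ x
    (FiberBundle.mem_baseSet_trivializationAt' x)).toLinearEquiv).finrank_eq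

theorem finiteDimensional_fiber [FiniteDimensional ℝ F] [VectorBundle ℝ F V] (x : M) :
    FiniteDimensional ℝ (V x) :=
  (((trivializationAt F V x).continuousLinearEquivAt ℝ x
    (FiberBundle.mem_baseSet_trivializationAt' x)).toLinearEquiv).symm.finiteDimensional

end SectionOperators

/-! ### A splitting gives an Euler grading -/

section SplittingOperators

variable {s : ℕ} {M : Type u} [TopologicalSpace M] [ChartedSpace (EuclideanSpace ℝ (Fin s)) M]
  {r : ℕ} {𝓜 : Supermanifold s M r}
  {F : Type*} [NormedAddCommGroup F] [NormedSpace ℝ F]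
  {V : M → Type*} [∀ x, AddCommGroup (V x)] [∀ x, Module ℝ (V x)] [∀ x, TopologicalSpace (V x)]
  [TopologicalSpace (TotalSpace F V)] [FiberBundle F V]

namespace Splitting

/-- The operator on the functions on a supermanifold that corresponds to operators on the fibers
of `Λ• V*`. -/
noncomputable def operator (φ : Splitting 𝓜 F V)
    (T : ∀ x, Module.End ℝ (ExteriorAlgebra ℝ (Module.Dual ℝ (V x))))
    (hT : ∀ η ∈ Algebra.adjoin ℝ (exteriorGenerators s F V),
      (fun x => T x (η x)) ∈ Algebra.adjoin ℝ (exteriorGenerators s F V)) :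
    Module.End ℝ 𝓜.Functions :=
  φ.toAlgEquiv.symm.toLinearEquiv.conj (sectionsOperator s F V T hT)

theorem apply_operator (φ : Splitting 𝓜 F V)
    (T : ∀ x, Module.End ℝ (ExteriorAlgebra ℝ (Module.Dual ℝ (V x))))
    (hT : ∀ η ∈ Algebra.adjoin ℝ (exteriorGenerators s F V),
      (fun x => T x (η x)) ∈ Algebra.adjoin ℝ (exteriorGenerators s F V))
    (a : 𝓜.Functions) (x : M) :
    (φ.toAlgEquiv (φ.operator T hT a)).1 x = T x ((φ.toAlgEquiv a).1 x) := by
  simp [operator, LinearEquiv.conj_apply, sectionsOperator]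

theorem eq_of_forall_apply (φ : Splitting 𝓜 F V) {a b : 𝓜.Functions}
    (h : ∀ x, (φ.toAlgEquiv a).1 x = (φ.toAlgEquiv b).1 x) : a = b :=
  φ.toAlgEquiv.injective (Subtype.ext (funext h))

theorem mem_functionDegree_zero (φ : Splitting 𝓜 F V) {a : 𝓜.Functions} (ha : φ.euler a = 0) :
    a ∈ φ.functionDegree 0 := by
  rw [← φ.euler_eq_iff, ha]
  simp

theorem mem_functionDegree_one (φ : Splitting 𝓜 F V) {a : 𝓜.Functions} (ha : φ.euler a = a) :
    a ∈ φ.functionDegree 1 := by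
  rw [← φ.euler_eq_iff, ha]
  simp

/-- A combination of products of smooth functions and smooth sections of `V*`, as a function on
the supermanifold. -/
noncomputable def ofAdjoin (φ : Splitting 𝓜 F V)
    (η : ∀ x, ExteriorAlgebra ℝ (Module.Dual ℝ (V x)))
    (hη : η ∈ Algebra.adjoin ℝ (exteriorGenerators s F V)) : 𝓜.Functions :=
  φ.toAlgEquiv.symm ⟨η, mem_exteriorSections_of_mem_adjoin s F V hη⟩

theorem apply_ofAdjoin (φ : Splitting 𝓜 F V)
    (η : ∀ x, ExteriorAlgebra ℝ (Module.Dual ℝ (V x)))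
    (hη : η ∈ Algebra.adjoin ℝ (exteriorGenerators s F V)) :
    (φ.toAlgEquiv (φ.ofAdjoin η hη)).1 = η := by
  simp [ofAdjoin]

/-- An even vector field that kills the functions of degree `0` and `1` vanishes. -/
theorem eq_zero_of_degree_le_one [T2Space M] [IsManifold (𝓡 s) ∞ M] (φ : Splitting 𝓜 F V)
    {X : Module.End ℝ 𝓜.Functions} (hX : X ∈ superDer (𝓜.parity ⊤) 0)
    (h0 : ∀ a, φ.euler a = 0 → X a = 0) (h1 : ∀ a, φ.euler a = a → X a = 0) : X = 0 := by
  -- The generators have degree 0 or 1, so the Leibniz rule disposes of all globally defined sums of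
  -- products.
  have key : ∀ η (hη : η ∈ Algebra.adjoin ℝ (exteriorGenerators s F V)),
      X (φ.ofAdjoin η hη) = 0 := by
    intro η hη
    induction hη using Algebra.adjoin_induction with
    | mem η h =>
      rcases h with ⟨f, rfl⟩ | ⟨α, hα, rfl⟩
      · refine h0 _ (φ.eq_of_forall_apply fun x => ?_)
        rw [φ.apply_euler, φ.apply_ofAdjoin, exteriorDegree_algebraMap]
        simp
      · refine h1 _ (φ.eq_of_forall_apply fun x => ?_)
        rw [φ.apply_euler, φ.apply_ofAdjoin, exteriorDegree_ι]
    | algebraMap c =>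
      refine h0 _ (φ.eq_of_forall_apply fun x => ?_)
      rw [φ.apply_euler, φ.apply_ofAdjoin, Pi.algebraMap_apply, exteriorDegree_algebraMap]
      simp
    | add η η' hη hη' h h' =>
      have : φ.ofAdjoin (η + η') (add_mem hη hη') = φ.ofAdjoin η hη + φ.ofAdjoin η' hη' := by
        refine φ.eq_of_forall_apply fun x => ?_
        simp [φ.apply_ofAdjoin]
      rw [this, map_add, h, h', add_zero]
    | mul η η' hη hη' h h' =>
      have : φ.ofAdjoin (η * η') (mul_mem hη hη') = φ.ofAdjoin η hη * φ.ofAdjoin η' hη' := by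
        refine φ.eq_of_forall_apply fun x => ?_
        simp [φ.apply_ofAdjoin]
      rw [this, superDer_zero_apply_mul hX, h, h', zero_mul, mul_zero, add_zero]
  ext a
  refine φ.eq_of_forall_apply fun x₀ => ?_
  obtain ⟨η, hη, e⟩ := (φ.toAlgEquiv a).2 x₀
  set b := φ.ofAdjoin η hη with hb
  obtain ⟨f, -, hf⟩ := (SmoothBumpFunction.nhds_basis_tsupport (I := 𝓡 s) x₀).mem_iff.1 e
  have hfmem : (fun x => algebraMap ℝ (ExteriorAlgebra ℝ (Module.Dual ℝ (V x))) (f x)) ∈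
      Algebra.adjoin ℝ (exteriorGenerators s F V) :=
    Algebra.subset_adjoin (Or.inl ⟨⟨f, f.contMDiff⟩, rfl⟩)
  -- Locality of derivations: the bump function is supported where `a` and `b` agree. Applying `X`,
  -- which kills both it and `b`, leaves `f * X a = 0`, and `f` is 1 at `x₀`.
  have hmul : φ.ofAdjoin _ hfmem * (a - b) = 0 := by
    refine φ.eq_of_forall_apply fun x => ?_
    rw [map_mul, map_sub, map_zero]
    change (φ.toAlgEquiv (φ.ofAdjoin _ hfmem)).1 x *
      ((φ.toAlgEquiv a).1 x - (φ.toAlgEquiv b).1 x) = 0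
    rw [hb, φ.apply_ofAdjoin, φ.apply_ofAdjoin]
    by_cases hx : x ∈ tsupport f
    · have hx' : (φ.toAlgEquiv a).1 x = η x := hf hx
      rw [hx', sub_self, mul_zero]
    · rw [image_eq_zero_of_notMem_tsupport hx, map_zero, zero_mul]
  have h2 := superDer_zero_apply_mul hX (φ.ofAdjoin _ hfmem) (a - b)
  rw [hmul, key, map_zero, zero_mul, zero_add, map_sub, hb, key, sub_zero] at h2
  have h3 : (φ.toAlgEquiv (φ.ofAdjoin _ hfmem * X a)).1 x₀ = 0 := by
    rw [← h2, map_zero]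
    rfl
  rw [map_mul] at h3
  change (φ.toAlgEquiv (φ.ofAdjoin _ hfmem)).1 x₀ * (φ.toAlgEquiv (X a)).1 x₀ = 0 at h3
  rw [φ.apply_ofAdjoin, f.eq_one, map_one, one_mul] at h3
  rw [h3, LinearMap.zero_apply, map_zero]
  rfl

/-- The value of a function on the supermanifold at a point of the body. -/
noncomputable def evalBody (φ : Splitting 𝓜 F V) (x : M) : 𝓜.Functions →ₐ[ℝ] ℝ :=
  (ExteriorAlgebra.algebraMapInv : ExteriorAlgebra ℝ (Module.Dual ℝ (V x)) →ₐ[ℝ] ℝ).comp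
    ((Pi.evalAlgHom ℝ _ x).comp ((exteriorSections s F V).val.comp φ.toAlgEquiv.toAlgHom))

theorem evalBody_eq (φ : Splitting 𝓜 F V) {x : M} {a : 𝓜.Functions} {c : ℝ}
    (h : (φ.toAlgEquiv a).1 x = algebraMap ℝ _ c) : φ.evalBody x a = c := by
  change ExteriorAlgebra.algebraMapInv ((φ.toAlgEquiv a).1 x) = c
  rw [h]
  exact ExteriorAlgebra.algebraMap_leftInverse _ c

/-- At some point `γ` is a nonzero covector. A vector on which it does not vanish extends to a
global section, and `D` is the contraction with that section. -/
theorem exists_contraction [T2Space M] [IsManifold (𝓡 s) ∞ M] [VectorBundle ℝ F V]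
    [ContMDiffVectorBundle ∞ F V (𝓡 s)] (φ : Splitting 𝓜 F V) {γ : 𝓜.Functions}
    (hγ : φ.euler γ = γ) (hne : γ ≠ 0) :
    ∃ D ∈ superDer (𝓜.parity ⊤) 1, D ∈ homogeneousOperators φ.euler (-1) ∧
      ∃ ev : 𝓜.Functions →ₐ[ℝ] ℝ, ev (D γ) ≠ 0 := by
  have hx : ∃ x, (φ.toAlgEquiv γ).1 x ≠ 0 := by
    by_contra! hcon
    refine hne (φ.eq_of_forall_apply fun x => ?_)
    rw [hcon x, map_zero]
    rfl
  obtain ⟨x, hx⟩ := hx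
  obtain ⟨α, hα⟩ := exists_ι_eq_of_mem (φ.mem_functionDegree_one hγ x)
  have hα0 : α ≠ 0 := by
    rintro rfl
    rw [← hα, map_zero] at hx
    exact hx rfl
  obtain ⟨v, hv⟩ : ∃ v, α v ≠ 0 := by
    by_contra! hcon
    exact hα0 (LinearMap.ext hcon)
  obtain ⟨σ, hσx, hσ⟩ := exists_contMDiff_section_eq s F V v
  refine ⟨φ.operator (fun x => exteriorContract (Module.Dual.eval ℝ (V x) (σ x)))
    (fun η hη => exteriorContract_mem_adjoin hσ hη), ?_, ?_, φ.evalBody x, ?_⟩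
  · intro q a ha
    rw [φ.parity_iff] at ha
    refine ⟨?_, fun b => φ.eq_of_forall_apply fun y => ?_⟩
    · rw [φ.parity_iff]
      intro y
      rw [φ.apply_operator]
      exact exteriorContract_mem_exteriorParity _ (ha y)
    · rw [φ.apply_operator, map_mul, map_add, map_smul, map_mul, map_mul]
      change exteriorContract _ ((φ.toAlgEquiv a).1 y * (φ.toAlgEquiv b).1 y) =
        (φ.toAlgEquiv (φ.operator _ _ a)).1 y * (φ.toAlgEquiv b).1 y +
          (-1 : ℝ) ^ ((1 : ZMod 2).val * q.val) • ((φ.toAlgEquiv a).1 y * (φ.toAlgEquiv (φ.operator _ _ b)).1 y)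
      rw [φ.apply_operator, φ.apply_operator, exteriorContract_mul,
        involute_of_mem_exteriorParity (ha y), ZMod.val_one, one_mul, smul_mul_assoc]
  · rw [mem_homogeneousOperators]
    refine LinearMap.ext fun a => φ.eq_of_forall_apply fun y => ?_
    rw [LinearMap.sub_apply, LinearMap.smul_apply, Module.End.mul_apply, Module.End.mul_apply,
      map_sub, map_smul]
    change (φ.toAlgEquiv (φ.euler (φ.operator _ _ a))).1 y -
        (φ.toAlgEquiv (φ.operator _ _ (φ.euler a))).1 y =
      (-1 : ℝ) • (φ.toAlgEquiv (φ.operator _ _ a)).1 y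
    rw [φ.apply_euler, φ.apply_operator, φ.apply_operator, φ.apply_euler,
      exteriorDegree_exteriorContract]
    simp
  · rw [φ.evalBody_eq (c := α v)]
    · exact hv
    · rw [φ.apply_operator, ← hα, hσx]
      exact CliffordAlgebra.contractLeft_ι _ _ _

theorem isEulerGrading [T2Space M] [IsManifold (𝓡 s) ∞ M] [FiniteDimensional ℝ F]
    [VectorBundle ℝ F V] [ContMDiffVectorBundle ∞ F V (𝓡 s)] (φ : Splitting 𝓜 F V) :
    IsEulerGrading (𝓜.parity ⊤) φ.euler (Module.finrank ℝ F) where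
  mem := φ.euler_mem
  exists_proj := by
    refine ⟨fun k => φ.operator (fun x => exteriorProj _ k)
      (fun η hη => exteriorProj_mem_adjoin k hη), ?_, fun j => ⟨?_, ?_⟩⟩
    · refine LinearMap.ext fun a => φ.eq_of_forall_apply fun x => ?_
      have := finiteDimensional_fiber F V x
      rw [LinearMap.sum_apply, map_sum, AddSubmonoidClass.coe_finsetSum, Finset.sum_apply,
        Module.End.one_apply]
      simp only [φ.apply_operator]
      rw [← finrank_dual_fiber F V x, sum_exteriorProj]
    · refine LinearMap.ext fun a => φ.eq_of_forall_apply fun x => ?_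
      rw [Module.End.mul_apply, φ.apply_euler, φ.apply_operator, LinearMap.smul_apply, map_smul]
      change _ = (j : ℝ) • (φ.toAlgEquiv (φ.operator _ _ a)).1 x
      rw [φ.apply_operator, exteriorDegree_exteriorProj]
    · refine LinearMap.ext fun a => φ.eq_of_forall_apply fun x => ?_
      rw [Module.End.mul_apply, φ.apply_operator, φ.apply_euler, LinearMap.smul_apply, map_smul]
      change _ = (j : ℝ) • (φ.toAlgEquiv (φ.operator _ _ a)).1 x
      rw [φ.apply_operator, exteriorProj_exteriorDegree]
  parity j a ha := by
    rw [φ.euler_eq_iff] at ha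
    rw [φ.parity_iff]
    exact fun x => mem_exteriorParity_of_mem (ha x)
  ext X hX h0 h1 := φ.eq_zero_of_degree_le_one hX h0 h1
  commute_of_zero f hf a := by
    refine φ.eq_of_forall_apply fun x => ?_
    obtain ⟨c, hc⟩ := exists_algebraMap_eq_of_mem (φ.mem_functionDegree_zero hf x)
    rw [map_mul, map_mul]
    change (φ.toAlgEquiv f).1 x * (φ.toAlgEquiv a).1 x =
      (φ.toAlgEquiv a).1 x * (φ.toAlgEquiv f).1 x
    rw [← hc]
    exact Algebra.commutes c _
  supercommute_of_one β hβ q a ha := by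
    refine φ.eq_of_forall_apply fun x => ?_
    obtain ⟨v, hv⟩ := exists_ι_eq_of_mem (φ.mem_functionDegree_one hβ x)
    rw [map_mul, map_smul, map_mul]
    change (φ.toAlgEquiv β).1 x * (φ.toAlgEquiv a).1 x =
      (-1 : ℝ) ^ q.val • ((φ.toAlgEquiv a).1 x * (φ.toAlgEquiv β).1 x)
    rw [← hv, ι_mul_eq_involute_mul_ι,
      involute_of_mem_exteriorParity ((φ.parity_iff q a).1 ha x), smul_mul_assoc]
  exists_eval f hf hne := by
    have hx : ∃ x, (φ.toAlgEquiv f).1 x ≠ 0 := by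
      by_contra! hcon
      refine hne (φ.eq_of_forall_apply fun x => ?_)
      rw [hcon x, map_zero]
      rfl
    obtain ⟨x, hx⟩ := hx
    obtain ⟨c, hc⟩ := exists_algebraMap_eq_of_mem (φ.mem_functionDegree_zero hf x)
    refine ⟨φ.evalBody x, ?_⟩
    rw [φ.evalBody_eq hc.symm]
    rintro rfl
    rw [← hc, map_zero] at hx
    exact hx rfl
  exists_contraction γ hγ hne := φ.exists_contraction hγ hne

theorem vectorFieldDegree_eq (φ : Splitting 𝓜 F V) (k : ℤ) :
    φ.vectorFieldDegree k = 𝓜.vectorFields ⊓ homogeneousOperators φ.euler k := by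
  ext X
  rw [Submodule.mem_inf, mem_homogeneousOperators, ← superBracket_even _ φ.euler_mem]
  rfl

theorem iSup_vectorFieldDegree (φ : Splitting 𝓜 F V) :
    ⨆ i : {i : ℕ // 0 < i}, φ.vectorFieldDegree (2 * (i : ℕ)) =
      positiveEvenFields (𝓜.parity ⊤) φ.euler := by
  refine iSup_congr fun i => ?_
  rw [φ.vectorFieldDegree_eq]
  push_cast
  rfl

/-- The summands lie in eigenspaces of `ad ε` for distinct eigenvalues. -/
theorem iSupIndep_vectorFieldDegree (φ : Splitting 𝓜 F V) :
    iSupIndep (fun i : {i : ℕ // 0 < i} => φ.vectorFieldDegree (2 * (i : ℕ))) := by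
  have h := (Module.End.eigenspaces_iSupIndep
    (LinearMap.mulLeft ℝ φ.euler - LinearMap.mulRight ℝ φ.euler)).comp
    (f := fun i : {i : ℕ // 0 < i} => (((2 * (i : ℕ) : ℤ)) : ℝ)) ?_
  · refine h.mono fun i => ?_
    rw [φ.vectorFieldDegree_eq]
    exact inf_le_right
  · intro i j hij
    simp only [Int.cast_inj] at hij
    ext
    omega

end Splitting

end SplittingOperators

/-! ### The largest ad-nilpotent ideal and independence of the splitting -/

theorem mainTheorem5 {s r : ℕ} {M : Type u} [TopologicalSpace M] [T2Space M]
    [SecondCountableTopology M] [ChartedSpace (EuclideanSpace ℝ (Fin s)) M]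
    [IsManifold (𝓡 s) ∞ M] (𝓜 : Supermanifold s M r)
    -- a smooth vector bundle `V` of rank `r` with a splitting `𝓜 ≅ ΠV`
    {F : Type*} [NormedAddCommGroup F] [NormedSpace ℝ F] [FiniteDimensional ℝ F]
    (hF : Module.finrank ℝ F = r)
    {V : M → Type*} [∀ x, AddCommGroup (V x)] [∀ x, Module ℝ (V x)]
    [∀ x, TopologicalSpace (V x)] [TopologicalSpace (TotalSpace F V)] [FiberBundle F V]
    [VectorBundle ℝ F V] [ContMDiffVectorBundle ∞ F V (𝓡 s)] (φ : Splitting 𝓜 F V)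
    -- another one
    {F' : Type*} [NormedAddCommGroup F'] [NormedSpace ℝ F'] [FiniteDimensional ℝ F']
    (hF' : Module.finrank ℝ F' = r)
    {V' : M → Type*} [∀ x, AddCommGroup (V' x)] [∀ x, Module ℝ (V' x)]
    [∀ x, TopologicalSpace (V' x)] [TopologicalSpace (TotalSpace F' V')] [FiberBundle F' V']
    [VectorBundle ℝ F' V'] [ContMDiffVectorBundle ∞ F' V' (𝓡 s)] (φ' : Splitting 𝓜 F' V') :
    -- there is a largest (hence a unique maximal) ideal of `𝔤₀` of ad-nilpotent elements
    (∃ 𝔤' : LieIdeal ℝ 𝓜.evenVectorFields, IsGreatest (adNilpotentIdeals (𝓜.parity ⊤)) 𝔤') ∧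
    -- every maximal such ideal is the direct sum of the `𝔤²ⁱ`, `i > 0`
    (∀ 𝔤' : LieIdeal ℝ 𝓜.evenVectorFields, Maximal (· ∈ adNilpotentIdeals (𝓜.parity ⊤)) 𝔤' →
      𝔤'.toSubmodule.map 𝓜.evenVectorFields.toSubmodule.subtype =
        ⨆ i : {i : ℕ // 0 < i}, φ.vectorFieldDegree (2 * (i : ℕ))) ∧
    iSupIndep (fun i : {i : ℕ // 0 < i} => φ.vectorFieldDegree (2 * (i : ℕ))) ∧
    -- which does not depend on the splitting
    (⨆ i : {i : ℕ // 0 < i}, φ.vectorFieldDegree (2 * (i : ℕ))) =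
      ⨆ i : {i : ℕ // 0 < i}, φ'.vectorFieldDegree (2 * (i : ℕ)) := by
  have h := φ.isEulerGrading
  have h' := φ'.isEulerGrading
  obtain ⟨J, hJ, hJe⟩ := h.exists_isGreatest_adNilpotentIdeals
  rw [φ.iSup_vectorFieldDegree, φ'.iSup_vectorFieldDegree]
  refine ⟨⟨J, hJ⟩, fun 𝔤' hmax => h.map_eq_positiveEvenFields hmax,
    φ.iSupIndep_vectorFieldDegree, ?_⟩
  -- The same ideal `J`, obtained from `φ`, is described a second time through `φ'`.
  rw [← hJe, h'.map_eq_positiveEvenFields hJ.maximal]
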